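/- Let $\Gamma$ be a countable discrete group in which every element other than the identity $e$ has an infinite conjugacy class, and let $G\le\Gamma$ be an infinite subgroup with $xGx^{-1}\cap G=\{e\}$ for all $x\in\Gamma\setminus G$. Let $\mathcal M=VN(\Gamma)$ be the von Neumann algebra on $\ell^2(\Gamma)$ generated by the left translations $\lambda_g$, $g\in\Gamma$, with normalized trace $\mathrm{tr}(x)=\langle x\delta_e,\delta_e\rangle$ and $\|x\|_2=\mathrm{tr}(x^*x)^{1/2}$, and let $\mathcal N=VN(G)\subseteq\mathcal M$ be the von Neumann algebra generated by $\lambda_g$, $g\in G$. For a von Neumann subalgebra $\mathcal B\subseteq\mathcal M$ let $\mathbb E_{\mathcal B}:\mathcal M\to\mathcal B$ denote the unique trace-preserving conditional expectation, and for a linear map $\phi:\mathcal M\to\mathcal M$ put $\|\phi\|_{\infty,2}=\sup\{\|\phi(x)\|_2:\ x\in\mathcal M,\ \|x\|\le 1\}$. Then the conditional expectations onto $\mathcal N$ and onto $u\mathcal Nu^*$, for $u\in\mathcal M$ unitary, exist and are unique, and the following hold. (i) For every unitary $u\in\mathcal M$, $$\|u-\mathbb E_{\mathcal N}(u)\|_2\le\|\mathbb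 E_{u\mathcal Nu^*}-\mathbb E_{\mathcal N}\|_{\infty,2}.$$ (ii) If $G$ is abelian, then $\mathcal N$ is a strongly singular masa of $\mathcal M$, that is, $\mathcal N$ is a maximal abelian self-adjoint subalgebra of $\mathcal M$ and $\|\mathbb E_{u\mathcal Nu^*}-\mathbb E_{\mathcal N}\|_{\infty,2}\ge\|u-\mathbb E_{\mathcal N}(u)\|_2$ for all unitaries $u\in\mathcal M$. Moreover $\alpha(\mathcal N)=\delta(\mathcal N)=1$, where $\alpha(\mathcal N)$ is the supremum of all real numbers $c$ such that $\|\mathbb E_{u\mathcal Nu^*}-\mathbb E_{\mathcal N}\|_{\infty,2}\ge c\,\|u-\mathbb E_{\mathcal N}(u)\|_2$ for all unitaries $u\in\mathcal M$, and $\delta(\mathcal N)$ is the largest real number $c$ such that $$\sup\{\|x-\mathbb E_{\mathcal N}(x)\|_2:\ x\in v\mathcal Nv^*,\ \|x\|\le 1\}\ \ge\ c\,\|v^*v\|_2$$ for all non-zero partial isometries $v\in\mathcal M$ such that $vv^*$ and $v^*v$ are orthogonal projections in $\mathcal N$. -/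

import Mathlib

open scoped lp

namespace Tracial

/-! ### Subalgebras of a tracial operator algebra

`M` is an operator algebra (it will be a finite von Neumann algebra with its operator norm),
`τ : M → ℂ` is its normalized trace and `N`, `A` are `*`-subalgebras of `M`. -/

section

variable {M : Type*} [NormedRing M] [StarRing M] [NormedAlgebra ℂ M] [StarModule ℂ M]

/-- The norm `‖x‖₂ = τ(x⋆x)^{1/2}` induced by the trace `τ`. -/
noncomputable def norm2 (τ : M →ₗ[ℂ] ℂ) (x : M) : ℝ :=
  Real.sqrt (τ (star x * x)).re

/-- `E` is a trace-preserving conditional expectation of `M` onto `N`: a linear projection of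
`M` onto `N` which is contractive for the operator norm, is an `N`-bimodule map, and preserves
the trace. -/
structure IsCondExp (τ : M →ₗ[ℂ] ℂ) (N : StarSubalgebra ℂ M) (E : M →ₗ[ℂ] M) : Prop where
  mem : ∀ x, E x ∈ N
  apply_of_mem : ∀ x ∈ N, E x = x
  bimodule : ∀ a ∈ N, ∀ b ∈ N, ∀ x, E (a * x * b) = a * E x * b
  norm_le : ∀ x, ‖E x‖ ≤ ‖x‖
  trace : ∀ x, τ (E x) = τ x

open Classical in
/-- The trace-preserving conditional expectation `E_N : M → N` (and `0` if there is none). -/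
noncomputable def condExp (τ : M →ₗ[ℂ] ℂ) (N : StarSubalgebra ℂ M) : M →ₗ[ℂ] M :=
  if h : ∃ E, IsCondExp τ N E then h.choose else 0

/-- The norm `‖φ‖_{∞,2}` of a linear map `φ : M → M`, when the domain carries the operator norm
and the range the norm `‖·‖₂`. -/
noncomputable def normInfTwo (τ : M →ₗ[ℂ] ℂ) (φ : M →ₗ[ℂ] M) : ℝ :=
  sSup {r : ℝ | ∃ x : M, ‖x‖ ≤ 1 ∧ r = norm2 τ (φ x)}

/-- The subalgebra `u A u⋆`, for a unitary `u` of `M`. -/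
noncomputable def conj (u : unitary M) (A : StarSubalgebra ℂ M) : StarSubalgebra ℂ M :=
  A.map (Unitary.conjStarAlgAut ℂ M u : M →⋆ₐ[ℂ] M)

theorem mem_conj {u : unitary M} {A : StarSubalgebra ℂ M} {y : M} :
    y ∈ conj u A ↔ ∃ a ∈ A, (u : M) * a * star (u : M) = y := by
  simp [conj, StarSubalgebra.mem_map, Unitary.conjStarAlgAut_apply]

/-- `A` is a masa of `M`: a maximal abelian self-adjoint subalgebra. -/
def IsMasa (A : StarSubalgebra ℂ M) : Prop :=
  Maximal (fun B : StarSubalgebra ℂ M => ∀ a ∈ B, ∀ b ∈ B, a * b = b * a) A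

/-- The inequality `‖E_{uAu⋆} - E_A‖_{∞,2} ≥ c ‖u - E_A(u)‖₂`, for all unitaries `u` of `M`. -/
def IsStronglySingularWith (τ : M →ₗ[ℂ] ℂ) (A : StarSubalgebra ℂ M) (c : ℝ) : Prop :=
  ∀ u : unitary M,
    c * norm2 τ ((u : M) - condExp τ A (u : M)) ≤
      normInfTwo τ (condExp τ (conj u A) - condExp τ A)

/-- `A` is a strongly singular masa of `M`. -/
def IsStronglySingularMasa (τ : M →ₗ[ℂ] ℂ) (A : StarSubalgebra ℂ M) : Prop :=
  IsMasa A ∧ IsStronglySingularWith τ A 1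

/-- The invariant `α(A)`: the supremum of all numbers `c` such that
`‖E_{uAu⋆} - E_A‖_{∞,2} ≥ c ‖u - E_A(u)‖₂` for all unitaries `u` of `M`. -/
noncomputable def alpha (τ : M →ₗ[ℂ] ℂ) (A : StarSubalgebra ℂ M) : ℝ :=
  sSup {c : ℝ | IsStronglySingularWith τ A c}

/-- `v` is a non-zero partial isometry of `M` such that `v v⋆` and `v⋆ v` are orthogonal
projections lying in `A`. -/
structure IsOrthogonalIsometryFor (A : StarSubalgebra ℂ M) (v : M) : Prop where
  ne_zero : v ≠ 0
  partial_isometry : v * star v * v = v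
  final_mem : v * star v ∈ A
  initial_mem : star v * v ∈ A
  orthogonal : (v * star v) * (star v * v) = 0

/-- `δ(vAv⋆, A) = sup {‖x - E_A(x)‖₂ : x ∈ vAv⋆, ‖x‖ ≤ 1}`. -/
noncomputable def deltaAt (τ : M →ₗ[ℂ] ℂ) (A : StarSubalgebra ℂ M) (v : M) : ℝ :=
  sSup {r : ℝ | ∃ a ∈ A, ‖v * a * star v‖ ≤ 1 ∧
    r = norm2 τ (v * a * star v - condExp τ A (v * a * star v))}

/-- Popa's invariant `δ(A)`: the largest number `c` such that
`δ(vAv⋆, A) ≥ c ‖v⋆v‖₂` for all non-zero partial isometries `v` of `M` such that `vv⋆` and `v⋆v`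
are orthogonal projections in `A`. -/
noncomputable def delta (τ : M →ₗ[ℂ] ℂ) (A : StarSubalgebra ℂ M) : ℝ :=
  sSup {c : ℝ | ∀ v : M, IsOrthogonalIsometryFor A v →
    c * norm2 τ (star v * v) ≤ deltaAt τ A v}

end

end Tracial

namespace GroupVN

/-! ### Group von Neumann algebras -/

section

variable {Γ : Type*} [Group Γ]

/-- The left regular representation: `(leftRegular g f) x = f (g⁻¹ x)`. -/
noncomputable def leftRegular (g : Γ) : ℓ²(Γ, ℂ) →L[ℂ] ℓ²(Γ, ℂ) :=
  LinearIsometry.toContinuousLinearMap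
    { toFun := fun f => ⟨fun x => f (g⁻¹ * x), by
        have hf := (memℓp_gen_iff (p := 2) (by simp)).mp (lp.memℓp f)
        exact memℓp_gen ((Equiv.mulLeft g⁻¹).summable_iff.mpr hf)⟩
      map_add' := fun f h => rfl
      map_smul' := fun c f => rfl
      norm_map' := fun f => by
        simp only [lp.norm_eq_tsum_rpow (p := 2) (by simp)]
        congr 1
        exact (Equiv.mulLeft g⁻¹).tsum_eq fun x => ‖f x‖ ^ (2 : ENNReal).toReal }

theorem leftRegular_apply (g : Γ) (f : ℓ²(Γ, ℂ)) (x : Γ) : leftRegular g f x = f (g⁻¹ * x) := rfl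

/-- The von Neumann algebra generated by a set `S` of bounded operators: the bicommutant of
`S ∪ S⋆`. -/
noncomputable def generated {H : Type*} [NormedAddCommGroup H] [InnerProductSpace ℂ H]
    [CompleteSpace H] (S : Set (H →L[ℂ] H)) : VonNeumannAlgebra H where
  toStarSubalgebra :=
    StarSubalgebra.centralizer ℂ (StarSubalgebra.centralizer ℂ S : Set (H →L[ℂ] H))
  centralizer_centralizer' := by
    change Set.centralizer (Set.centralizer
      ((StarSubalgebra.centralizer ℂ (StarSubalgebra.centralizer ℂ S : Set (H →L[ℂ] H)) :
        StarSubalgebra ℂ (H →L[ℂ] H)) : Set (H →L[ℂ] H))) =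
      ((StarSubalgebra.centralizer ℂ (StarSubalgebra.centralizer ℂ S : Set (H →L[ℂ] H)) :
        StarSubalgebra ℂ (H →L[ℂ] H)) : Set (H →L[ℂ] H))
    rw [StarSubalgebra.coe_centralizer_centralizer, Set.centralizer_centralizer_centralizer]

/-- The von Neumann algebra on `ℓ²(Γ)` generated by the left translations by elements of the
subgroup `G`. -/
noncomputable def vn (G : Subgroup Γ) : VonNeumannAlgebra ℓ²(Γ, ℂ) :=
  generated (leftRegular '' (G : Set Γ))

theorem vn_mono {G K : Subgroup Γ} (h : G ≤ K) :
    (vn G).toStarSubalgebra ≤ (vn K).toStarSubalgebra :=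
  StarSubalgebra.centralizer_le ℂ _ _
    (StarSubalgebra.centralizer_le ℂ _ _ (Set.image_mono h))

variable (Γ) in
/-- The group von Neumann algebra `VN(Γ)`. -/
abbrev VN : Type _ :=
  ↥(vn (⊤ : Subgroup Γ)).toStarSubalgebra

/-- `VN(G)`, for a subgroup `G` of `Γ`, as a subalgebra of `VN(Γ)`. -/
noncomputable def subVN (G : Subgroup Γ) : StarSubalgebra ℂ (VN Γ) :=
  (vn G).toStarSubalgebra.comap (vn (⊤ : Subgroup Γ)).toStarSubalgebra.subtype

theorem map_subVN (G : Subgroup Γ) :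
    (subVN G).map (vn (⊤ : Subgroup Γ)).toStarSubalgebra.subtype = (vn G).toStarSubalgebra := by
  ext x
  constructor
  · rintro ⟨y, hy, rfl⟩
    exact hy
  · intro hx
    exact ⟨⟨x, vn_mono le_top hx⟩, hx, rfl⟩

open Classical in
/-- The unit vector `δ_e` of `ℓ²(Γ)`. -/
noncomputable def deltaOne : ℓ²(Γ, ℂ) := lp.single 2 (1 : Γ) (1 : ℂ)

variable (Γ) in
/-- The normalized trace `x ↦ ⟨x δ_e, δ_e⟩` of `VN(Γ)` (linear in `x`). -/
noncomputable def trace : VN Γ →ₗ[ℂ] ℂ where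
  toFun x := inner ℂ (deltaOne : ℓ²(Γ, ℂ)) ((x : ℓ²(Γ, ℂ) →L[ℂ] ℓ²(Γ, ℂ)) deltaOne)
  map_add' x y := by simp
  map_smul' c x := by simp

end

end GroupVN

/-- An I.C.C. group: each element other than the identity has an infinite conjugacy class. -/
def IsICC (Γ : Type*) [Group Γ] : Prop :=
  ∀ g : Γ, g ≠ 1 → (conjugatesOf g).Infinite

/-! An element x of `VN(Γ)` is determined by its vector xδ_e, and ‖x‖₂ is the norm of that vector.
On vectors, the expectation E onto `VN(G)` is restriction of coordinates to G.

Malnormality enters through one asymptotic statement. If a ∉ G, then agb ∈ G for at most one g ∈ G.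
Hence E(λ_a λ_g λ_b) = E(λ_a) λ_g E(λ_b) for all but finitely many g ∈ G, and by density ‖E(x λ_g y)
− E(x) λ_g E(y)‖₂ → 0 as g leaves finite subsets of G, for all x, y (`tendsto_asymptotic`).

For (i), put w = u λ_g u⋆, a unitary of u`VN(G)`u⋆, and let K be the norm of the difference of the
expectations. Pythagoras gives 1 = ‖E(w)‖₂² + ‖w − E(w)‖₂² ≤ ‖E(w)‖₂² + K². Asymptotically ‖E(w)‖₂ ≤
‖E(u)‖₂, so K² ≥ 1 − ‖E(u)‖₂² = ‖u − E(u)‖₂². The value α = 1 is attained at u = λ_g with g ∉ G. For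
δ ≥ 1 the same argument runs with v λ_g v⋆, where E(v) = 0.

The bound δ ≤ 1 requires some admissible v to exist. Extreme points of weak-operator compact sets
supply it: an extreme trace-zero self-adjoint contraction of `VN(G)` is a symmetry, which splits 1
into orthogonal projections of trace 1/2. An extreme contraction of a corner of `VN(Γ)` is a partial
isometry, and the i.c.c. condition makes it link these two projections. -/

namespace GroupVN

/-! ### Coordinates and operators on ℓ²(Γ) -/

section

variable {Γ : Type*}

open Classical in
/-- The standard basis vector `δ_g` of `ℓ²(Γ)`. -/
noncomputable def basisVec (g : Γ) : ℓ²(Γ, ℂ) := lp.single 2 g (1 : ℂ)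

theorem basisVec_apply_self (g : Γ) : basisVec g g = 1 := by
  simp [basisVec]

theorem basisVec_apply_ne {g k : Γ} (h : k ≠ g) : basisVec g k = 0 := by
  simp [basisVec, h]

theorem norm_basisVec (g : Γ) : ‖basisVec g‖ = 1 := by
  classical
  rw [basisVec, lp.norm_single (by norm_num)]
  simp

theorem inner_basisVec (g : Γ) (f : ℓ²(Γ, ℂ)) : inner ℂ (basisVec g) f = f g := by
  classical
  have := lp.inner_single_left (𝕜 := ℂ) (G := fun _ : Γ => ℂ) g (1 : ℂ) f
  simp only [basisVec]
  convert this using 1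
  simp

theorem hasSum_basisVec (f : ℓ²(Γ, ℂ)) : HasSum (fun g => f g • basisVec g) f := by
  classical
  have := lp.hasSum_single (E := fun _ : Γ => ℂ) (p := 2) (by norm_num) f
  convert this using 2 with g
  rw [basisVec, ← lp.single_smul]
  simp

theorem clm_ext {A B : ℓ²(Γ, ℂ) →L[ℂ] ℓ²(Γ, ℂ)} (h : ∀ g, A (basisVec g) = B (basisVec g)) :
    A = B := by
  ext1 f
  refine ((hasSum_basisVec f).mapL A).unique ?_
  convert (hasSum_basisVec f).mapL B using 2 with g
  simp [h]

theorem hasSum_apply (A : ℓ²(Γ, ℂ) →L[ℂ] ℓ²(Γ, ℂ)) (f : ℓ²(Γ, ℂ)) (k : Γ) :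
    HasSum (fun l => f l * A (basisVec l) k) (A f k) := by
  have := (((hasSum_basisVec f).mapL A).mapL (innerSL ℂ (basisVec k)))
  simpa only [innerSL_apply_apply, inner_basisVec, map_smul, smul_eq_mul] using this

theorem norm_sq_eq (f : ℓ²(Γ, ℂ)) : ‖f‖ ^ 2 = ∑' k, ‖f k‖ ^ 2 := by
  have := lp.norm_rpow_eq_tsum (p := 2) (by norm_num) f
  simpa using this

theorem summable_norm_sq (f : ℓ²(Γ, ℂ)) : Summable fun k => ‖f k‖ ^ 2 := by
  have := (memℓp_gen_iff (p := 2) (by simp)).mp (lp.memℓp f)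
  simpa using this

/-- A vector of `ℓ²(Γ)` whose modulus is constant along an infinite injective family vanishes
there. -/
theorem apply_eq_zero_of_infinite {ι : Type*} [Infinite ι] (f : ℓ²(Γ, ℂ)) {e : ι → Γ}
    (he : Function.Injective e) {c : ℝ} (h : ∀ i, ‖f (e i)‖ = c) : c = 0 := by
  have h1 := ((summable_norm_sq f).comp_injective he).tendsto_cofinite_zero
  have h2 : ((fun k => ‖f k‖ ^ 2) ∘ e) = fun _ => c ^ 2 := by
    funext i; simp [h]
  rw [h2] at h1
  have := tendsto_nhds_unique h1 tendsto_const_nhds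
  simpa using this.symm

/-! ### Restriction of vectors to subsets -/

/-- The orthogonal projection of `ℓ²(Γ)` onto `ℓ²(s)`. -/
noncomputable def cut (s : Set Γ) : ℓ²(Γ, ℂ) →L[ℂ] ℓ²(Γ, ℂ) :=
  LinearMap.mkContinuous
    { toFun := fun f => ⟨s.indicator f, by
        refine memℓp_gen (Summable.of_nonneg_of_le (fun k => by positivity) (fun k => ?_)
          ((memℓp_gen_iff (p := 2) (by simp)).mp (lp.memℓp f)))
        gcongr
        exact norm_indicator_le_norm_self _ _⟩
      map_add' := fun f h => by
        ext k
        exact congrFun (Set.indicator_add' s f h) k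
      map_smul' := fun c f => by
        ext k
        exact congrFun (Set.indicator_const_smul s c f) k } 1 (fun f => by
      rw [one_mul]
      refine lp.norm_le_of_forall_sum_le (p := 2) (by norm_num) (norm_nonneg _) fun F => ?_
      refine (Finset.sum_le_sum fun k _ => ?_).trans
        (lp.sum_rpow_le_norm_rpow (p := 2) (by norm_num) f F)
      gcongr
      exact norm_indicator_le_norm_self _ _)

open Classical in
theorem cut_apply (s : Set Γ) (f : ℓ²(Γ, ℂ)) (k : Γ) :
    cut s f k = if k ∈ s then f k else 0 :=
  Set.indicator_apply s f k

theorem cut_apply_of_mem {s : Set Γ} (f : ℓ²(Γ, ℂ)) {k : Γ} (hk : k ∈ s) : cut s f k = f k :=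
  Set.indicator_of_mem hk f

theorem cut_apply_of_notMem {s : Set Γ} (f : ℓ²(Γ, ℂ)) {k : Γ} (hk : k ∉ s) : cut s f k = 0 :=
  Set.indicator_of_notMem hk f

theorem norm_cut_apply_le (s : Set Γ) (f : ℓ²(Γ, ℂ)) : ‖cut s f‖ ≤ ‖f‖ :=
  ((cut s).le_of_opNorm_le (LinearMap.mkContinuous_norm_le _ zero_le_one _) f).trans
    (by rw [one_mul])

theorem norm_cut_sq_add (s : Set Γ) (f : ℓ²(Γ, ℂ)) :
    ‖cut s f‖ ^ 2 + ‖f - cut s f‖ ^ 2 = ‖f‖ ^ 2 := by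
  classical
  rw [norm_sq_eq, norm_sq_eq, norm_sq_eq, ← (summable_norm_sq _).tsum_add (summable_norm_sq _)]
  congr 1
  ext k
  rw [lp.coeFn_sub, Pi.sub_apply, cut_apply]
  split_ifs <;> simp

end

section

variable {Γ : Type*} [Group Γ]

/-! ### Translations -/

/-- The right regular representation: `(rightRegular g f) x = f (x g)`. -/
noncomputable def rightRegular (g : Γ) : ℓ²(Γ, ℂ) →L[ℂ] ℓ²(Γ, ℂ) :=
  LinearIsometry.toContinuousLinearMap
    { toFun := fun f => ⟨fun x => f (x * g), by
        have hf := (memℓp_gen_iff (p := 2) (by simp)).mp (lp.memℓp f)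
        exact memℓp_gen ((Equiv.mulRight g).summable_iff.mpr hf)⟩
      map_add' := fun f h => rfl
      map_smul' := fun c f => rfl
      norm_map' := fun f => by
        simp only [lp.norm_eq_tsum_rpow (p := 2) (by simp)]
        congr 1
        exact (Equiv.mulRight g).tsum_eq fun x => ‖f x‖ ^ (2 : ENNReal).toReal }

theorem rightRegular_apply (g : Γ) (f : ℓ²(Γ, ℂ)) (x : Γ) : rightRegular g f x = f (x * g) := rfl

theorem norm_leftRegular_apply (g : Γ) (f : ℓ²(Γ, ℂ)) : ‖leftRegular g f‖ = ‖f‖ := by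
  rw [leftRegular, LinearIsometry.coe_toContinuousLinearMap, LinearIsometry.norm_map]

theorem norm_rightRegular_apply (g : Γ) (f : ℓ²(Γ, ℂ)) : ‖rightRegular g f‖ = ‖f‖ := by
  rw [rightRegular, LinearIsometry.coe_toContinuousLinearMap, LinearIsometry.norm_map]

theorem leftRegular_basisVec (g h : Γ) : leftRegular g (basisVec h) = basisVec (g * h) := by
  ext k
  rw [leftRegular_apply]
  by_cases hk : k = g * h
  · subst hk; simp [basisVec_apply_self]
  · rw [basisVec_apply_ne hk, basisVec_apply_ne]
    rintro rfl; simp at hk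

theorem rightRegular_basisVec (g h : Γ) : rightRegular g (basisVec h) = basisVec (h * g⁻¹) := by
  ext k
  rw [rightRegular_apply]
  by_cases hk : k = h * g⁻¹
  · subst hk; simp [basisVec_apply_self]
  · rw [basisVec_apply_ne hk, basisVec_apply_ne]
    rintro rfl; simp at hk

theorem leftRegular_mul (g h : Γ) : leftRegular g * leftRegular h = leftRegular (g * h) := by
  ext f k
  simp [leftRegular_apply, mul_assoc]

theorem leftRegular_one : leftRegular (1 : Γ) = 1 := by
  ext f k
  simp [leftRegular_apply]

theorem star_leftRegular (g : Γ) : star (leftRegular g) = leftRegular g⁻¹ := by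
  refine clm_ext fun h => ?_
  ext k
  rw [← inner_basisVec, ContinuousLinearMap.star_eq_adjoint,
    ContinuousLinearMap.adjoint_inner_right, leftRegular_basisVec, leftRegular_basisVec,
    inner_basisVec]
  by_cases hk : h = g * k
  · subst hk; simp [basisVec_apply_self]
  · rw [basisVec_apply_ne (Ne.symm hk), basisVec_apply_ne]
    rintro rfl; simp at hk

theorem leftRegular_rightRegular (g h : Γ) :
    leftRegular g * rightRegular h = rightRegular h * leftRegular g := by
  ext f k
  simp [leftRegular_apply, rightRegular_apply, mul_assoc]

/-! ### The group von Neumann algebras -/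

theorem mem_centralizer_leftRegular {G : Subgroup Γ} {T : ℓ²(Γ, ℂ) →L[ℂ] ℓ²(Γ, ℂ)} :
    T ∈ StarSubalgebra.centralizer ℂ (leftRegular '' (G : Set Γ)) ↔
      ∀ g ∈ G, leftRegular g * T = T * leftRegular g := by
  rw [StarSubalgebra.mem_centralizer_iff]
  constructor
  · intro h g hg
    exact (h _ ⟨g, hg, rfl⟩).1
  · rintro h _ ⟨g, hg, rfl⟩
    refine ⟨h g hg, ?_⟩
    rw [star_leftRegular]
    exact h _ (G.inv_mem hg)

theorem mem_vn_iff_commute {G : Subgroup Γ} {x : ℓ²(Γ, ℂ) →L[ℂ] ℓ²(Γ, ℂ)} :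
    x ∈ (vn G).toStarSubalgebra ↔
      ∀ T : ℓ²(Γ, ℂ) →L[ℂ] ℓ²(Γ, ℂ), (∀ g ∈ G, leftRegular g * T = T * leftRegular g) →
        T * x = x * T := by
  change x ∈ StarSubalgebra.centralizer ℂ _ ↔ _
  rw [StarSubalgebra.mem_centralizer_iff]
  constructor
  · intro h T hT
    exact (h T (mem_centralizer_leftRegular.mpr hT)).1
  · intro h T hT
    exact ⟨h T (mem_centralizer_leftRegular.mp hT),
      h _ (mem_centralizer_leftRegular.mp (star_mem hT))⟩

/-- Since gG = G for g ∈ G, the projection onto ℓ²(G) lies in the commutant of `VN(G)`. This gives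
the support condition in `mem_vn_iff` and the bimodule property of the expectation. -/
theorem cut_leftRegular {G : Subgroup Γ} {g : Γ} (hg : g ∈ G) :
    leftRegular g * cut (G : Set Γ) = cut (G : Set Γ) * leftRegular g := by
  ext f k
  have h : g⁻¹ * k ∈ (G : Set Γ) ↔ k ∈ (G : Set Γ) := G.mul_mem_cancel_left (G.inv_mem hg)
  rw [mul_apply_eq_comp, leftRegular_apply, mul_apply_eq_comp]
  by_cases hk : k ∈ (G : Set Γ)
  · rw [cut_apply_of_mem _ hk, cut_apply_of_mem _ (h.mpr hk), leftRegular_apply]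
  · rw [cut_apply_of_notMem _ hk, cut_apply_of_notMem _ (mt h.mp hk)]

/-- Commuting with right translations makes x a left convolution: its matrix entries depend only on
kh⁻¹. -/
theorem apply_basisVec {x : ℓ²(Γ, ℂ) →L[ℂ] ℓ²(Γ, ℂ)}
    (hx : ∀ g : Γ, rightRegular g * x = x * rightRegular g) (h k : Γ) :
    x (basisVec h) k = x (basisVec 1) (k * h⁻¹) := by
  have h1 := congrArg (fun A => A (basisVec 1) k) (hx h⁻¹)
  simp only [mul_apply_eq_comp, rightRegular_basisVec, rightRegular_apply] at h1
  simpa using h1.symm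

/-- The von Neumann algebra of `G` consists of the operators that commute with the right
translations and whose symbol is supported in `G`. -/
theorem mem_vn_iff {G : Subgroup Γ} {x : ℓ²(Γ, ℂ) →L[ℂ] ℓ²(Γ, ℂ)} :
    x ∈ (vn G).toStarSubalgebra ↔
      (∀ g : Γ, rightRegular g * x = x * rightRegular g) ∧ ∀ k ∉ G, x (basisVec 1) k = 0 := by
  rw [mem_vn_iff_commute]
  constructor
  · intro h
    refine ⟨fun g => h _ fun k _ => leftRegular_rightRegular k g, fun k hk => ?_⟩
    have h1 := congrArg (fun A => A (basisVec 1) k) (h (cut (G : Set Γ)) fun g hg =>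
      cut_leftRegular hg)
    simp only [mul_apply_eq_comp, cut_apply, SetLike.mem_coe, hk, if_false] at h1
    have h2 : cut (G : Set Γ) (basisVec 1) = basisVec 1 := by
      ext l
      rw [cut_apply]
      split_ifs with hl
      · rfl
      · rw [basisVec_apply_ne]
        rintro rfl
        exact hl G.one_mem
    rw [h2] at h1
    exact h1.symm
  · rintro ⟨hx, hs⟩ T hT
    refine clm_ext fun h => ?_
    ext k
    have h1 := hasSum_apply T (x (basisVec h)) k
    have h2 := hasSum_apply x (T (basisVec h)) k
    -- Reindexing by l ↦ kl⁻¹h matches the two matrix products term by term: both then carry the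
    -- symbol of x at kl⁻¹, which vanishes off G, and for kl⁻¹ ∈ G the entries of T agree because T
    -- commutes with that translation.
    let e : Γ ≃ Γ := ((Equiv.inv Γ).trans (Equiv.mulLeft k)).trans (Equiv.mulRight h)
    rw [← e.hasSum_iff] at h1
    refine HasSum.unique h1 (?_ : HasSum _ (x (T (basisVec h)) k))
    convert h2 using 2 with l
    have he : e l = k * l⁻¹ * h := rfl
    simp only [Function.comp_apply, he]
    rw [apply_basisVec hx h, apply_basisVec hx l, mul_inv_cancel_right, mul_comm]
    by_cases hk : k * l⁻¹ ∈ G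
    · congr 1
      have h3 := congrArg (fun A => A (basisVec h) k) (hT _ hk)
      simp only [mul_apply_eq_comp, leftRegular_basisVec, leftRegular_apply] at h3
      rw [← h3]
      simp
    · simp [hs _ hk]

theorem mem_vn_top {x : ℓ²(Γ, ℂ) →L[ℂ] ℓ²(Γ, ℂ)} :
    x ∈ (vn (⊤ : Subgroup Γ)).toStarSubalgebra ↔
      ∀ g : Γ, rightRegular g * x = x * rightRegular g := by
  rw [mem_vn_iff]
  simp

theorem leftRegular_mem_vn {G : Subgroup Γ} {g : Γ} (hg : g ∈ G) :
    leftRegular g ∈ (vn G).toStarSubalgebra :=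
  mem_vn_iff_commute.mpr fun _ hT => (hT g hg).symm

end

end GroupVN

namespace GroupVN

/-! ### Block diagonal compressions -/

section

variable {Γ Q : Type*}

theorem sum_norm_cut_sq_le (f : Γ → Q) (C : Finset Q) (ξ : ℓ²(Γ, ℂ)) :
    ∑ c ∈ C, ‖cut (f ⁻¹' {c}) ξ‖ ^ 2 ≤ ‖ξ‖ ^ 2 := by
  classical
  simp_rw [norm_sq_eq]
  rw [← Summable.tsum_finsetSum fun c _ => summable_norm_sq _]
  refine Summable.tsum_le_tsum (fun k => ?_) (summable_sum fun c _ => summable_norm_sq _)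
    (summable_norm_sq _)
  calc ∑ c ∈ C, ‖cut (f ⁻¹' {c}) ξ k‖ ^ 2
      = ∑ c ∈ C, if f k = c then ‖ξ k‖ ^ 2 else 0 := by
        refine Finset.sum_congr rfl fun c _ => ?_
        rw [cut_apply]
        by_cases h : f k = c <;> simp [h]
    _ ≤ ‖ξ k‖ ^ 2 := by
        rw [Finset.sum_ite_eq]
        split_ifs
        · exact le_rfl
        · positivity

/-- Each block has norm at most ‖x‖, and the restrictions of ξ to distinct fibres are orthogonal, so
the block estimates add up. -/
theorem sum_norm_blockDiag_sq_le (f : Γ → Q) (x : ℓ²(Γ, ℂ) →L[ℂ] ℓ²(Γ, ℂ)) (ξ : ℓ²(Γ, ℂ))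
    (F : Finset Γ) :
    ∑ k ∈ F, ‖x (cut (f ⁻¹' {f k}) ξ) k‖ ^ 2 ≤ (‖x‖ * ‖ξ‖) ^ 2 := by
  classical
  calc ∑ k ∈ F, ‖x (cut (f ⁻¹' {f k}) ξ) k‖ ^ 2
      = ∑ c ∈ F.image f, ∑ k ∈ F with f k = c, ‖x (cut (f ⁻¹' {f k}) ξ) k‖ ^ 2 :=
        (Finset.sum_fiberwise_of_maps_to (fun k hk => Finset.mem_image_of_mem f hk) _).symm
    _ ≤ ∑ c ∈ F.image f, ‖x‖ ^ 2 * ‖cut (f ⁻¹' {c}) ξ‖ ^ 2 := by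
        refine Finset.sum_le_sum fun c _ => ?_
        calc ∑ k ∈ F with f k = c, ‖x (cut (f ⁻¹' {f k}) ξ) k‖ ^ 2
            = ∑ k ∈ F with f k = c, ‖x (cut (f ⁻¹' {c}) ξ) k‖ ^ 2 := by
              refine Finset.sum_congr rfl fun k hk => ?_
              rw [(Finset.mem_filter.mp hk).2]
          _ ≤ ‖x (cut (f ⁻¹' {c}) ξ)‖ ^ 2 := by
              rw [norm_sq_eq]
              exact (summable_norm_sq _).sum_le_tsum _ fun _ _ => by positivity
          _ ≤ ‖x‖ ^ 2 * ‖cut (f ⁻¹' {c}) ξ‖ ^ 2 := by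
              rw [← mul_pow]
              gcongr
              exact x.le_opNorm _
    _ ≤ ‖x‖ ^ 2 * ‖ξ‖ ^ 2 := by
        rw [← Finset.mul_sum]
        gcongr
        exact sum_norm_cut_sq_le f _ ξ
    _ = (‖x‖ * ‖ξ‖) ^ 2 := (mul_pow _ _ _).symm

/-- The block diagonal part of an operator on `ℓ²(Γ)`, for the partition of `Γ` into the fibres
of `f`. -/
noncomputable def blockDiag (f : Γ → Q) (x : ℓ²(Γ, ℂ) →L[ℂ] ℓ²(Γ, ℂ)) :
    ℓ²(Γ, ℂ) →L[ℂ] ℓ²(Γ, ℂ) :=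
  LinearMap.mkContinuous
    { toFun := fun ξ => ⟨fun k => x (cut (f ⁻¹' {f k}) ξ) k,
        memℓp_gen' (C := (‖x‖ * ‖ξ‖) ^ 2) fun F => by
          simpa using sum_norm_blockDiag_sq_le f x ξ F⟩
      map_add' := fun ξ η => by
        ext k
        simp only [map_add]
        rfl
      map_smul' := fun c ξ => by
        ext k
        simp only [map_smul]
        rfl } ‖x‖ fun ξ =>
      lp.norm_le_of_forall_sum_le (p := 2) (by norm_num) (by positivity) fun F => by
        simpa using sum_norm_blockDiag_sq_le f x ξ F

theorem blockDiag_apply (f : Γ → Q) (x : ℓ²(Γ, ℂ) →L[ℂ] ℓ²(Γ, ℂ)) (ξ : ℓ²(Γ, ℂ)) (k : Γ) :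
    blockDiag f x ξ k = x (cut (f ⁻¹' {f k}) ξ) k := rfl

theorem norm_blockDiag_le (f : Γ → Q) (x : ℓ²(Γ, ℂ) →L[ℂ] ℓ²(Γ, ℂ)) :
    ‖blockDiag f x‖ ≤ ‖x‖ :=
  LinearMap.mkContinuous_norm_le _ (norm_nonneg _) _

theorem cut_eq_self {s : Set Γ} {ξ : ℓ²(Γ, ℂ)} (h : ∀ k ∉ s, ξ k = 0) : cut s ξ = ξ := by
  ext k
  rw [cut_apply]
  split_ifs with hk
  · rfl
  · exact (h k hk).symm

theorem cut_eq_zero {s : Set Γ} {ξ : ℓ²(Γ, ℂ)} (h : ∀ k ∈ s, ξ k = 0) : cut s ξ = 0 := by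
  ext k
  rw [cut_apply]
  split_ifs with hk
  · rw [h k hk]; rfl
  · rfl

end

/-! ### Vectors and the trace of a group von Neumann algebra -/

section

variable {Γ : Type*} [Group Γ]

/-- The vector `x δ_e` of an element `x` of `VN(Γ)`. -/
noncomputable def vec : VN Γ →ₗ[ℂ] ℓ²(Γ, ℂ) where
  toFun x := (x : ℓ²(Γ, ℂ) →L[ℂ] ℓ²(Γ, ℂ)) (basisVec 1)
  map_add' _ _ := rfl
  map_smul' _ _ := rfl

theorem vec_apply (x : VN Γ) : vec x = (x : ℓ²(Γ, ℂ) →L[ℂ] ℓ²(Γ, ℂ)) (basisVec 1) := rfl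

theorem vn_commute (x : VN Γ) (g : Γ) :
    rightRegular g * (x : ℓ²(Γ, ℂ) →L[ℂ] ℓ²(Γ, ℂ)) = x * rightRegular g :=
  mem_vn_top.mp x.2 g

theorem coe_basisVec (x : VN Γ) (h : Γ) :
    (x : ℓ²(Γ, ℂ) →L[ℂ] ℓ²(Γ, ℂ)) (basisVec h) = rightRegular h⁻¹ (vec x) := by
  have h1 := congrArg (fun A => A (basisVec 1)) (vn_commute x h⁻¹)
  simp only [mul_apply_eq_comp, rightRegular_basisVec, one_mul, inv_inv] at h1
  exact h1.symm

/-- The vector δ_e is separating: x commutes with right translations, which carry δ_e to every basis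
vector. -/
theorem vec_injective : Function.Injective (vec : VN Γ → ℓ²(Γ, ℂ)) := by
  intro x y h
  refine Subtype.ext (clm_ext fun g => ?_)
  rw [coe_basisVec, coe_basisVec, h]

theorem vec_mul (x y : VN Γ) :
    vec (x * y) = (x : ℓ²(Γ, ℂ) →L[ℂ] ℓ²(Γ, ℂ)) (vec y) := rfl

theorem trace_apply (x : VN Γ) : trace Γ x = vec x 1 := by
  rw [← inner_basisVec]
  rfl

theorem trace_star_mul (x y : VN Γ) : trace Γ (star x * y) = inner ℂ (vec x) (vec y) := by
  rw [trace_apply, ← inner_basisVec, vec_mul]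
  change inner ℂ (basisVec 1) (star (x : ℓ²(Γ, ℂ) →L[ℂ] ℓ²(Γ, ℂ)) (vec y)) = _
  rw [ContinuousLinearMap.star_eq_adjoint, ContinuousLinearMap.adjoint_inner_right]
  rfl

theorem vec_star_apply (x : VN Γ) (k : Γ) : vec (star x) k = star (vec x k⁻¹) := by
  rw [← inner_basisVec]
  change inner ℂ (basisVec k) (star (x : ℓ²(Γ, ℂ) →L[ℂ] ℓ²(Γ, ℂ)) (basisVec 1)) = _
  rw [ContinuousLinearMap.star_eq_adjoint, ContinuousLinearMap.adjoint_inner_right, coe_basisVec,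
    ← inner_conj_symm, inner_basisVec, rightRegular_apply, one_mul]
  rfl

theorem trace_mul_comm (x y : VN Γ) : trace Γ (x * y) = trace Γ (y * x) := by
  rw [← star_star x, trace_star_mul, ← star_star y, star_star x, trace_star_mul, star_star y]
  rw [lp.inner_eq_tsum, lp.inner_eq_tsum, ← (Equiv.inv Γ).tsum_eq]
  congr 1
  ext k
  simp only [Equiv.inv_apply, vec_star_apply, inv_inv, RCLike.inner_apply]
  rw [RCLike.star_def, RCLike.conj_conj, RCLike.conj_conj, mul_comm]

theorem norm2_eq (x : VN Γ) : Tracial.norm2 (trace Γ) x = ‖vec x‖ := by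
  rw [Tracial.norm2, trace_star_mul]
  exact (norm_eq_sqrt_re_inner (𝕜 := ℂ) _).symm

theorem norm_vec_star (x : VN Γ) : ‖vec (star x)‖ = ‖vec x‖ := by
  rw [← norm2_eq, ← norm2_eq, Tracial.norm2, Tracial.norm2, star_star, trace_mul_comm]

theorem norm_vec_mul_le_left (x y : VN Γ) : ‖vec (x * y)‖ ≤ ‖x‖ * ‖vec y‖ :=
  ContinuousLinearMap.le_opNorm _ _

/-- The trace property makes the adjoint isometric for ‖·‖₂, which transfers the left-handed
estimate. -/
theorem norm_vec_mul_le_right (x y : VN Γ) : ‖vec (x * y)‖ ≤ ‖vec x‖ * ‖y‖ := by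
  rw [← norm_vec_star, star_mul, mul_comm, ← norm_vec_star x]
  refine (norm_vec_mul_le_left _ _).trans_eq ?_
  rw [norm_star]

theorem norm_vec_le (x : VN Γ) : ‖vec x‖ ≤ ‖x‖ := by
  refine (ContinuousLinearMap.le_opNorm _ _).trans_eq ?_
  rw [norm_basisVec, mul_one]
  rfl

theorem mem_subVN_iff {G : Subgroup Γ} {x : VN Γ} : x ∈ subVN G ↔ ∀ k ∉ G, vec x k = 0 := by
  change (x : ℓ²(Γ, ℂ) →L[ℂ] ℓ²(Γ, ℂ)) ∈ (vn G).toStarSubalgebra ↔ _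
  rw [mem_vn_iff]
  exact and_iff_right (vn_commute x)

/-! ### The conditional expectation onto the von Neumann algebra of a subgroup -/

/-- The space of right cosets `G k`. -/
abbrev rightCoset (G : Subgroup Γ) : Γ → Quotient (QuotientGroup.rightRel G) := Quotient.mk _

theorem rightCoset_eq_iff {G : Subgroup Γ} {k l : Γ} :
    rightCoset G k = rightCoset G l ↔ l * k⁻¹ ∈ G := by
  rw [Quotient.eq, QuotientGroup.rightRel_apply]

theorem cut_rightRegular (G : Subgroup Γ) (g k : Γ) (ξ : ℓ²(Γ, ℂ)) :
    cut (rightCoset G ⁻¹' {rightCoset G k}) (rightRegular g ξ) =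
      rightRegular g (cut (rightCoset G ⁻¹' {rightCoset G (k * g)}) ξ) := by
  ext l
  have h : l * g ∈ rightCoset G ⁻¹' {rightCoset G (k * g)} ↔
      l ∈ rightCoset G ⁻¹' {rightCoset G k} := by
    simp only [Set.mem_preimage, Set.mem_singleton_iff, rightCoset_eq_iff, mul_inv_rev, mul_assoc,
      mul_inv_cancel_left]
  rw [rightRegular_apply]
  by_cases hl : l ∈ rightCoset G ⁻¹' {rightCoset G k}
  · rw [cut_apply_of_mem _ hl, cut_apply_of_mem _ (h.mpr hl), rightRegular_apply]
  · rw [cut_apply_of_notMem _ hl, cut_apply_of_notMem _ (mt h.mp hl)]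

/-- Right translations permute the right cosets Gk, so compressing to these blocks preserves
commutation with them and stays in `VN(Γ)`. -/
theorem blockDiag_commute (G : Subgroup Γ) (x : VN Γ) (g : Γ) :
    rightRegular g * blockDiag (rightCoset G) (x : ℓ²(Γ, ℂ) →L[ℂ] ℓ²(Γ, ℂ)) =
      blockDiag (rightCoset G) (x : ℓ²(Γ, ℂ) →L[ℂ] ℓ²(Γ, ℂ)) * rightRegular g := by
  ext ξ k
  have h := congrArg (fun A => A (cut (rightCoset G ⁻¹' {rightCoset G (k * g)}) ξ) k)
    (vn_commute x g)
  simp only [mul_apply_eq_comp, rightRegular_apply] at h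
  simp only [mul_apply_eq_comp, rightRegular_apply, blockDiag_apply, cut_rightRegular, h]

theorem rightCoset_preimage_of_mem {G : Subgroup Γ} {k : Γ} (hk : k ∈ G) :
    rightCoset G ⁻¹' {rightCoset G k} = (G : Set Γ) := by
  ext l
  rw [Set.mem_preimage, Set.mem_singleton_iff, rightCoset_eq_iff, SetLike.mem_coe]
  constructor
  · intro h
    simpa using G.inv_mem (G.mul_mem (G.inv_mem hk) h)
  · intro h
    exact G.mul_mem hk (G.inv_mem h)

theorem notMem_of_rightCoset_eq {G : Subgroup Γ} {k l : Γ} (hk : k ∉ G)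
    (h : l ∈ rightCoset G ⁻¹' {rightCoset G k}) : l ∉ G := by
  rw [Set.mem_preimage, Set.mem_singleton_iff, rightCoset_eq_iff] at h
  intro hl
  exact hk (by simpa using G.mul_mem h hl)

theorem blockDiag_of_support {G : Subgroup Γ} {ξ : ℓ²(Γ, ℂ)} (hξ : ∀ k ∉ G, ξ k = 0)
    (x : ℓ²(Γ, ℂ) →L[ℂ] ℓ²(Γ, ℂ)) :
    blockDiag (rightCoset G) x ξ = cut (G : Set Γ) (x ξ) := by
  ext k
  rw [blockDiag_apply]
  by_cases hk : k ∈ G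
  · rw [cut_apply_of_mem _ hk, rightCoset_preimage_of_mem hk, cut_eq_self hξ]
  · rw [cut_apply_of_notMem _ hk, cut_eq_zero fun l hl => hξ l (notMem_of_rightCoset_eq hk hl), map_zero]
    rfl

/-- The conditional expectation of `VN(Γ)` onto `VN(G)`. -/
noncomputable def expect (G : Subgroup Γ) : VN Γ →ₗ[ℂ] VN Γ where
  toFun x := ⟨blockDiag (rightCoset G) (x : ℓ²(Γ, ℂ) →L[ℂ] ℓ²(Γ, ℂ)),
    mem_vn_top.mpr (blockDiag_commute G x)⟩
  map_add' _ _ := rfl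
  map_smul' _ _ := rfl

theorem coe_expect (G : Subgroup Γ) (x : VN Γ) {ξ : ℓ²(Γ, ℂ)} (hξ : ∀ k ∉ G, ξ k = 0) :
    (expect G x : ℓ²(Γ, ℂ) →L[ℂ] ℓ²(Γ, ℂ)) ξ =
      cut (G : Set Γ) ((x : ℓ²(Γ, ℂ) →L[ℂ] ℓ²(Γ, ℂ)) ξ) :=
  blockDiag_of_support hξ _

theorem basisVec_one_support {G : Subgroup Γ} (k : Γ) (hk : k ∉ G) : basisVec (1 : Γ) k = 0 :=
  basisVec_apply_ne fun h => hk (h ▸ G.one_mem)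

theorem vec_expect (G : Subgroup Γ) (x : VN Γ) : vec (expect G x) = cut (G : Set Γ) (vec x) :=
  coe_expect G x basisVec_one_support

open Classical in
theorem vec_expect_apply (G : Subgroup Γ) (x : VN Γ) (k : Γ) :
    vec (expect G x) k = if k ∈ G then vec x k else 0 := by
  rw [vec_expect, cut_apply]
  rfl

/-- Defining E by block compression makes operator contractivity immediate, while the cut of the
vector to G gives everything else. The bimodule law holds because elements of `VN(G)` commute with
that cut and b sends δ_e into ℓ²(G). -/
theorem isCondExp_expect (G : Subgroup Γ) :
    Tracial.IsCondExp (trace Γ) (subVN G) (expect G) where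
  mem x := mem_subVN_iff.mpr fun k hk => by rw [vec_expect_apply, if_neg hk]
  apply_of_mem x hx := vec_injective (by
    rw [vec_expect, cut_eq_self (mem_subVN_iff.mp hx)])
  bimodule a ha b hb x := vec_injective (by
    have h := (mem_vn_iff_commute.mp (show (a : ℓ²(Γ, ℂ) →L[ℂ] ℓ²(Γ, ℂ)) ∈
      (vn G).toStarSubalgebra from ha)) (cut (G : Set Γ)) fun g hg => cut_leftRegular hg
    have h1 := congrArg (fun A => A ((x : ℓ²(Γ, ℂ) →L[ℂ] ℓ²(Γ, ℂ)) (vec b))) h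
    simp only [mul_apply_eq_comp] at h1
    rw [vec_expect, mul_assoc, vec_mul, vec_mul, h1, mul_assoc, vec_mul, vec_mul,
      coe_expect G x (mem_subVN_iff.mp hb)])
  norm_le x := norm_blockDiag_le _ _
  trace x := by rw [trace_apply, trace_apply, vec_expect_apply, if_pos G.one_mem]

end

end GroupVN

namespace GroupVN

open Filter Topology

section

variable {Γ : Type*} [Group Γ]

/-! ### Uniqueness of conditional expectations, and conjugation by unitaries -/

theorem IsCondExp.trace_mul {N : StarSubalgebra ℂ (VN Γ)} {E : VN Γ →ₗ[ℂ] VN Γ}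
    (h : Tracial.IsCondExp (trace Γ) N E) {a : VN Γ} (ha : a ∈ N) (x : VN Γ) :
    trace Γ (a * E x) = trace Γ (a * x) := by
  have h1 := h.bimodule a ha 1 N.one_mem x
  rw [mul_one, mul_one] at h1
  rw [← h1, h.trace]

/-- The difference d = E(x) − E'(x) lies in N and is trace-orthogonal to N, so τ(d⋆d) = 0. -/
theorem IsCondExp.unique {N : StarSubalgebra ℂ (VN Γ)} {E E' : VN Γ →ₗ[ℂ] VN Γ}
    (h : Tracial.IsCondExp (trace Γ) N E) (h' : Tracial.IsCondExp (trace Γ) N E') : E = E' := by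
  ext1 x
  rw [← sub_eq_zero]
  have hd : star (E x - E' x) ∈ N := star_mem (sub_mem (h.mem x) (h'.mem x))
  have h1 : trace Γ (star (E x - E' x) * (E x - E' x)) = 0 := by
    rw [mul_sub, map_sub, IsCondExp.trace_mul h hd, IsCondExp.trace_mul h' hd, sub_self]
  rw [trace_star_mul, inner_self_eq_zero] at h1
  exact vec_injective (h1.trans (map_zero _).symm)

theorem condExp_eq {N : StarSubalgebra ℂ (VN Γ)} {E : VN Γ →ₗ[ℂ] VN Γ}
    (h : Tracial.IsCondExp (trace Γ) N E) : Tracial.condExp (trace Γ) N = E := by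
  have hex : ∃ E, Tracial.IsCondExp (trace Γ) N E := ⟨E, h⟩
  rw [Tracial.condExp, dif_pos hex]
  exact IsCondExp.unique hex.choose_spec h

/-- The map `x ↦ u E(u⋆ x u) u⋆`. -/
noncomputable def conjMap (u : unitary (VN Γ)) (E : VN Γ →ₗ[ℂ] VN Γ) : VN Γ →ₗ[ℂ] VN Γ where
  toFun x := u * E (star (u : VN Γ) * x * u) * star (u : VN Γ)
  map_add' x y := by simp only [mul_add, add_mul, map_add]
  map_smul' c x := by simp only [mul_smul_comm, smul_mul_assoc, map_smul, RingHom.id_apply]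

theorem conjMap_apply (u : unitary (VN Γ)) (E : VN Γ →ₗ[ℂ] VN Γ) (x : VN Γ) :
    conjMap u E x = u * E (star (u : VN Γ) * x * u) * star (u : VN Γ) := rfl

theorem trace_conj {v w : VN Γ} (h : w * v = 1) (x : VN Γ) :
    trace Γ (v * x * w) = trace Γ x := by
  rw [trace_mul_comm (v * x) w, ← mul_assoc, h, one_mul]

theorem isCondExp_conjMap {N : StarSubalgebra ℂ (VN Γ)} {E : VN Γ →ₗ[ℂ] VN Γ}
    (h : Tracial.IsCondExp (trace Γ) N E) (u : unitary (VN Γ)) :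
    Tracial.IsCondExp (trace Γ) (Tracial.conj u N) (conjMap u E) := by
  have hu : star (u : VN Γ) * u = 1 := Unitary.coe_star_mul_self u
  have hu' : (u : VN Γ) * star (u : VN Γ) = 1 := Unitary.coe_mul_star_self u
  refine ⟨fun x => ?_, fun x hx => ?_, fun a ha b hb x => ?_, fun x => ?_, fun x => ?_⟩
  · exact Tracial.mem_conj.mpr ⟨_, h.mem _, rfl⟩
  · obtain ⟨a, ha, rfl⟩ := Tracial.mem_conj.mp hx
    have : star (u : VN Γ) * (u * a * star (u : VN Γ)) * u = a := by
      simp only [mul_assoc, hu, mul_one]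
      rw [← mul_assoc, hu, one_mul]
    rw [conjMap_apply, this, h.apply_of_mem a ha]
  · obtain ⟨a, ha', rfl⟩ := Tracial.mem_conj.mp ha
    obtain ⟨b, hb', rfl⟩ := Tracial.mem_conj.mp hb
    have : star (u : VN Γ) * (u * a * star (u : VN Γ) * x * (u * b * star (u : VN Γ))) * u =
        a * (star (u : VN Γ) * x * u) * b := by
      calc _ = (star (u : VN Γ) * u) * a * (star (u : VN Γ) * x * u) * b *
            (star (u : VN Γ) * u) := by simp only [mul_assoc]
        _ = _ := by rw [hu, one_mul, mul_one]
    rw [conjMap_apply, this, h.bimodule a ha' b hb', conjMap_apply]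
    symm
    calc _ = (u : VN Γ) * a * (star (u : VN Γ) * u) * E (star (u : VN Γ) * x * u) *
          (star (u : VN Γ) * u) * b * star (u : VN Γ) := by simp only [mul_assoc]
      _ = _ := by rw [hu, mul_one, mul_one]; simp only [mul_assoc]
  · rw [conjMap_apply]
    have e1 : ∀ y : VN Γ, ‖(u : VN Γ) * y‖ = ‖y‖ := fun y => CStarRing.norm_coe_unitary_mul u y
    have e2 : ∀ y : VN Γ, ‖y * star (u : VN Γ)‖ = ‖y‖ := fun y =>
      CStarRing.norm_mul_coe_unitary y (star u)
    have e3 : ∀ y : VN Γ, ‖star (u : VN Γ) * y‖ = ‖y‖ := fun y =>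
      CStarRing.norm_coe_unitary_mul (star u) y
    have e4 : ∀ y : VN Γ, ‖y * (u : VN Γ)‖ = ‖y‖ := fun y => CStarRing.norm_mul_coe_unitary y u
    rw [e2, e1]
    refine (h.norm_le _).trans_eq ?_
    rw [e4, e3]
  · rw [conjMap_apply, trace_conj hu, h.trace, trace_conj hu']

theorem IsCondExp.norm_vec_le_one {N : StarSubalgebra ℂ (VN Γ)} {E : VN Γ →ₗ[ℂ] VN Γ}
    (h : Tracial.IsCondExp (trace Γ) N E) {x : VN Γ} (hx : ‖x‖ ≤ 1) : ‖vec (E x)‖ ≤ 1 :=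
  (norm_vec_le _).trans ((h.norm_le x).trans hx)

theorem norm_vec_le_normInfTwo {N N' : StarSubalgebra ℂ (VN Γ)} {E E' : VN Γ →ₗ[ℂ] VN Γ}
    (h : Tracial.IsCondExp (trace Γ) N E) (h' : Tracial.IsCondExp (trace Γ) N' E') {x : VN Γ}
    (hx : ‖x‖ ≤ 1) : ‖vec (E x - E' x)‖ ≤ Tracial.normInfTwo (trace Γ) (E - E') := by
  -- The supremum is meaningful only for a bounded set; the bound 2 comes from two contractive
  -- expectations.
  refine le_csSup ⟨2, ?_⟩ ⟨x, hx, (norm2_eq _).symm⟩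
  rintro _ ⟨y, hy, rfl⟩
  rw [norm2_eq, LinearMap.sub_apply, map_sub]
  refine (norm_sub_le _ _).trans ?_
  linarith [IsCondExp.norm_vec_le_one h hy, IsCondExp.norm_vec_le_one h' hy]

/-! ### Translations as elements of the von Neumann algebra -/

/-- The left translation `λ_g` as an element of `VN(Γ)`. -/
noncomputable def lam (g : Γ) : VN Γ := ⟨leftRegular g, leftRegular_mem_vn trivial⟩

theorem vec_lam (g : Γ) : vec (lam g) = basisVec g := by
  rw [vec_apply]
  exact (leftRegular_basisVec g 1).trans (by rw [mul_one])

theorem lam_mul (g h : Γ) : lam g * lam h = lam (g * h) := Subtype.ext (leftRegular_mul g h)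

theorem lam_one : lam (1 : Γ) = 1 := Subtype.ext leftRegular_one

theorem star_lam (g : Γ) : star (lam g) = lam g⁻¹ := Subtype.ext (star_leftRegular g)

theorem lam_mem_unitary (g : Γ) : lam g ∈ unitary (VN Γ) := by
  rw [Unitary.mem_iff, star_lam, lam_mul, lam_mul, inv_mul_cancel, mul_inv_cancel, lam_one]
  exact ⟨rfl, rfl⟩

theorem norm_mul_lam (x : VN Γ) (g : Γ) : ‖x * lam g‖ = ‖x‖ :=
  CStarRing.norm_mul_coe_unitary x ⟨lam g, lam_mem_unitary g⟩

theorem norm_lam_mul (g : Γ) (x : VN Γ) : ‖lam g * x‖ = ‖x‖ :=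
  CStarRing.norm_coe_unitary_mul ⟨lam g, lam_mem_unitary g⟩ x

theorem norm_vec_unitary (u : unitary (VN Γ)) : ‖vec (u : VN Γ)‖ = 1 := by
  rw [← norm2_eq, Tracial.norm2, Unitary.coe_star_mul_self, trace_apply, ← lam_one, vec_lam,
    basisVec_apply_self]
  simp

theorem norm_unitary (u : unitary (VN Γ)) : ‖(u : VN Γ)‖ ≤ 1 := by
  have : Nontrivial (VN Γ) := ⟨1, 0, fun h => by
    have h1 := congrArg (fun x => vec x 1) h
    rw [← lam_one] at h1
    simp [vec_lam, basisVec_apply_self] at h1⟩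
  exact (CStarRing.norm_coe_unitary u).le

theorem lam_mem_subVN {G : Subgroup Γ} {g : Γ} (hg : g ∈ G) : lam g ∈ subVN G :=
  leftRegular_mem_vn hg

theorem expect_lam_of_mem {G : Subgroup Γ} {g : Γ} (hg : g ∈ G) : expect G (lam g) = lam g :=
  (isCondExp_expect G).apply_of_mem _ (lam_mem_subVN hg)

theorem expect_lam_of_notMem {G : Subgroup Γ} {g : Γ} (hg : g ∉ G) : expect G (lam g) = 0 := by
  refine vec_injective ?_
  rw [vec_expect, vec_lam, map_zero, cut_eq_zero]
  intro k hk
  refine basisVec_apply_ne ?_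
  rintro rfl
  exact hg hk

theorem norm_vec_expect_le (G : Subgroup Γ) (x : VN Γ) : ‖vec (expect G x)‖ ≤ ‖vec x‖ := by
  rw [vec_expect]
  exact norm_cut_apply_le _ _

theorem norm_vec_expect_sq_add (G : Subgroup Γ) (x : VN Γ) :
    ‖vec (expect G x)‖ ^ 2 + ‖vec (x - expect G x)‖ ^ 2 = ‖vec x‖ ^ 2 := by
  rw [map_sub, vec_expect, norm_cut_sq_add]

/-! ### The asymptotic homomorphism property -/

/-- Finite combinations of the λ_a are ‖·‖₂-dense, and the bound C is uniform in i, so convergence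
passes from the λ_a to all x. -/
theorem tendsto_zero_of_lam {ι : Type*} {l : Filter ι} (D : ι → VN Γ →ₗ[ℂ] ℓ²(Γ, ℂ)) (C : ℝ)
    (hC : ∀ i x, ‖D i x‖ ≤ C * ‖vec x‖) (h : ∀ a, Tendsto (fun i => D i (lam a)) l (𝓝 0))
    (x : VN Γ) : Tendsto (fun i => D i x) l (𝓝 0) := by
  rw [Metric.tendsto_nhds]
  intro ε hε
  have hpos : 0 < |C| + 1 := by positivity
  obtain ⟨F, hF⟩ := ((Metric.tendsto_nhds.mp (hasSum_basisVec (vec x))) (ε / 2 / (|C| + 1))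
    (by positivity)).exists
  set x₀ : VN Γ := ∑ k ∈ F, vec x k • lam k with hx₀
  have hvec : vec x₀ = ∑ k ∈ F, vec x k • basisVec k := by
    simp only [hx₀, map_sum, map_smul, vec_lam]
  have h0 : Tendsto (fun i => D i x₀) l (𝓝 0) := by
    simp only [hx₀, map_sum, map_smul]
    have := tendsto_finsetSum F fun k _ => (h k).const_smul (vec x k)
    simpa using this
  filter_upwards [Metric.tendsto_nhds.mp h0 (ε / 2) (by positivity)] with i hi
  rw [dist_zero_right] at hi ⊢
  have h1 : ‖D i (x - x₀)‖ < ε / 2 := by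
    rw [dist_comm, dist_eq_norm, ← hvec, ← map_sub] at hF
    calc ‖D i (x - x₀)‖ ≤ C * ‖vec (x - x₀)‖ := hC _ _
      _ ≤ (|C| + 1) * ‖vec (x - x₀)‖ := by
        gcongr
        linarith [le_abs_self C]
      _ < (|C| + 1) * (ε / 2 / (|C| + 1)) := by gcongr
      _ = ε / 2 := by field_simp
  calc ‖D i x‖ = ‖D i (x - x₀) + D i x₀‖ := by rw [← map_add, sub_add_cancel]
    _ ≤ ‖D i (x - x₀)‖ + ‖D i x₀‖ := norm_add_le _ _
    _ < ε := by linarith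

variable {G : Subgroup Γ}

theorem eq_one_of_malnormal
    (hG : ∀ x : Γ, x ∉ G → G.map (MulAut.conj x).toMonoidHom ⊓ G = ⊥) {x g : Γ} (hx : x ∉ G)
    (hg : g ∈ G) (h : x * g * x⁻¹ ∈ G) : g = 1 := by
  have h1 : x * g * x⁻¹ ∈ G.map (MulAut.conj x).toMonoidHom ⊓ G := ⟨⟨g, hg, rfl⟩, h⟩
  rw [hG x hx, Subgroup.mem_bot] at h1
  simpa using h1

/-- When a ∉ G, the right side is 0 and the left side is nonzero only if agb ∈ G. Two such elements
g, g' would give a(gg'⁻¹)a⁻¹ ∈ G, hence g = g' by malnormality. -/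
theorem eventually_expect_lam
    (hG : ∀ x : Γ, x ∉ G → G.map (MulAut.conj x).toMonoidHom ⊓ G = ⊥) (a b : Γ) :
    ∀ᶠ g : G in cofinite, expect G (lam a * lam (g : Γ) * lam b) =
      expect G (lam a) * lam (g : Γ) * expect G (lam b) := by
  by_cases ha : a ∈ G
  · refine Eventually.of_forall fun g => ?_
    by_cases hb : b ∈ G
    · rw [expect_lam_of_mem ha, expect_lam_of_mem hb, lam_mul, lam_mul,
        expect_lam_of_mem (G.mul_mem (G.mul_mem ha g.2) hb)]
    · rw [expect_lam_of_notMem hb, lam_mul, lam_mul, mul_zero, expect_lam_of_notMem]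
      rwa [G.mul_mem_cancel_left (G.mul_mem ha g.2)]
  · rw [eventually_cofinite]
    refine Set.Subsingleton.finite fun g hg g' hg' => ?_
    have key : ∀ g : G, ¬ expect G (lam a * lam (g : Γ) * lam b) =
        expect G (lam a) * lam (g : Γ) * expect G (lam b) → a * g * b ∈ G := by
      intro g hg
      by_contra hn
      refine hg ?_
      rw [expect_lam_of_notMem ha, zero_mul, zero_mul, lam_mul, lam_mul, expect_lam_of_notMem hn]
    have h1 := G.mul_mem (key g hg) (G.inv_mem (key g' hg'))
    have h2 : a * g * b * (a * g' * b)⁻¹ = a * (g * (g' : Γ)⁻¹) * a⁻¹ := by group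
    rw [h2] at h1
    have h3 := eq_one_of_malnormal hG ha (G.mul_mem g.2 (G.inv_mem g'.2)) h1
    exact Subtype.ext (mul_inv_eq_one.mp h3)

/-- Density is used in one variable at a time: the fixed variable is controlled in operator norm,
the approximated one in ‖·‖₂. The companion estimate exchanges the roles. -/
theorem norm_asymptotic_le_right (x y : VN Γ) (g : Γ) :
    ‖vec (expect G (x * lam g * y) - expect G x * lam g * expect G y)‖ ≤
      2 * ‖x‖ * ‖vec y‖ := by
  rw [map_sub]
  refine (norm_sub_le _ _).trans ?_
  have h1 : ‖vec (expect G (x * lam g * y))‖ ≤ ‖x‖ * ‖vec y‖ := by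
    refine (norm_vec_expect_le _ _).trans ((norm_vec_mul_le_left _ _).trans_eq ?_)
    rw [norm_mul_lam]
  have h2 : ‖vec (expect G x * lam g * expect G y)‖ ≤ ‖x‖ * ‖vec y‖ := by
    refine (norm_vec_mul_le_left _ _).trans ?_
    rw [norm_mul_lam]
    gcongr
    · exact (isCondExp_expect G).norm_le x
    · exact norm_vec_expect_le _ _
  linarith

theorem norm_asymptotic_le_left (x y : VN Γ) (g : Γ) :
    ‖vec (expect G (x * lam g * y) - expect G x * lam g * expect G y)‖ ≤
      2 * ‖y‖ * ‖vec x‖ := by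
  rw [map_sub]
  refine (norm_sub_le _ _).trans ?_
  have h1 : ‖vec (expect G (x * lam g * y))‖ ≤ ‖vec x‖ * ‖y‖ := by
    rw [mul_assoc]
    refine (norm_vec_expect_le _ _).trans ((norm_vec_mul_le_right _ _).trans_eq ?_)
    rw [norm_lam_mul]
  have h2 : ‖vec (expect G x * lam g * expect G y)‖ ≤ ‖vec x‖ * ‖y‖ := by
    rw [mul_assoc]
    refine (norm_vec_mul_le_right _ _).trans ?_
    rw [norm_lam_mul]
    gcongr
    · exact norm_vec_expect_le _ _
    · exact (isCondExp_expect G).norm_le y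
  linarith

/-- The conditional expectation onto `VN(G)` is an asymptotic homomorphism along the translations
by elements of the malnormal subgroup `G`. -/
theorem tendsto_asymptotic
    (hG : ∀ x : Γ, x ∉ G → G.map (MulAut.conj x).toMonoidHom ⊓ G = ⊥) (x y : VN Γ) :
    Tendsto (fun g : G => vec (expect G (x * lam (g : Γ) * y) -
      expect G x * lam (g : Γ) * expect G y)) cofinite (𝓝 0) := by
  have step : ∀ a : Γ, Tendsto (fun g : G => vec (expect G (lam a * lam (g : Γ) * y) -
      expect G (lam a) * lam (g : Γ) * expect G y)) cofinite (𝓝 0) := by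
    intro a
    refine tendsto_zero_of_lam (fun g : G => vec ∘ₗ
      (expect G ∘ₗ LinearMap.mulLeft ℂ (lam a * lam (g : Γ)) -
        LinearMap.mulLeft ℂ (expect G (lam a) * lam (g : Γ)) ∘ₗ expect G)) (2 * ‖lam a‖)
      (fun g y => norm_asymptotic_le_right _ _ _) (fun b => ?_) y
    refine tendsto_const_nhds.congr' ?_
    filter_upwards [eventually_expect_lam hG a b] with g hg
    change 0 = vec (expect G (lam a * lam (g : Γ) * lam b) -
      expect G (lam a) * lam (g : Γ) * expect G (lam b))
    rw [hg, sub_self, map_zero]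
  refine tendsto_zero_of_lam (fun g : G => vec ∘ₗ
      (expect G ∘ₗ LinearMap.mulRight ℂ y ∘ₗ LinearMap.mulRight ℂ (lam (g : Γ)) -
        LinearMap.mulRight ℂ (expect G y) ∘ₗ LinearMap.mulRight ℂ (lam (g : Γ)) ∘ₗ expect G))
      (2 * ‖y‖) (fun g x => norm_asymptotic_le_left _ _ _) step x

/-! ### Perturbation of the subalgebra by a unitary -/

theorem norm_vec_expect_mul_le (x y : VN Γ) (hy : ‖y‖ ≤ 1) (g : Γ) :
    ‖vec (expect G (x * lam g * y))‖ ≤ ‖vec (expect G x)‖ +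
      ‖vec (expect G (x * lam g * y) - expect G x * lam g * expect G y)‖ := by
  have h1 : ‖vec (expect G x * lam g * expect G y)‖ ≤ ‖vec (expect G x)‖ := by
    rw [mul_assoc]
    refine (norm_vec_mul_le_right _ _).trans ?_
    rw [norm_lam_mul]
    exact mul_le_of_le_one_right (norm_nonneg _) (((isCondExp_expect G).norm_le y).trans hy)
  rw [map_sub]
  have h2 := norm_sub_norm_le (vec (expect G (x * lam g * y)))
    (vec (expect G x * lam g * expect G y))
  linarith

theorem le_of_forall_le_tendsto_zero {ι : Type*} {l : Filter ι} [l.NeBot] {f : ι → ℝ}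
    (hf : Tendsto f l (𝓝 0)) {a b c : ℝ} (h : ∀ i, a ≤ (b + f i) ^ 2 + c) : a ≤ b ^ 2 + c := by
  have h1 : Tendsto (fun i => (b + f i) ^ 2 + c) l (𝓝 ((b + 0) ^ 2 + c)) :=
    ((hf.const_add b).pow 2).add_const c
  rw [add_zero] at h1
  exact ge_of_tendsto' h1 h

/-- The unitary w = uλ_gu⋆ is fixed by the conjugated expectation, so w − E(w) is a value of the
difference of expectations at a contraction; then apply Pythagoras. -/
theorem norm_vec_conj_lam_le (u : unitary (VN Γ)) {g : Γ} (hg : g ∈ G) :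
    1 ≤ ‖vec (expect G (u * lam g * star (u : VN Γ)))‖ ^ 2 +
      Tracial.normInfTwo (trace Γ) (conjMap u (expect G) - expect G) ^ 2 := by
  let w : unitary (VN Γ) := u * ⟨lam g, lam_mem_unitary _⟩ * star u
  have hw : (w : VN Γ) = u * lam g * star (u : VN Γ) := rfl
  have h1 := norm_vec_expect_sq_add G (w : VN Γ)
  have hE := isCondExp_expect G
  have hEu := isCondExp_conjMap hE u
  have h2 := norm_vec_le_normInfTwo hEu hE (norm_unitary w)
  rw [hEu.apply_of_mem w (Tracial.mem_conj.mpr ⟨_, lam_mem_subVN hg, rfl⟩)] at h2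
  rw [norm_vec_unitary, one_pow, hw] at h1
  rw [hw] at h2
  rw [← h1]
  gcongr

/-- Let g leave finite subsets of G in the preceding inequality. Infinitude of G makes the cofinite
filter nontrivial. -/
theorem norm_vec_sub_expect_le [Infinite G]
    (hG : ∀ x : Γ, x ∉ G → G.map (MulAut.conj x).toMonoidHom ⊓ G = ⊥) (u : unitary (VN Γ)) :
    ‖vec ((u : VN Γ) - expect G u)‖ ≤
      Tracial.normInfTwo (trace Γ) (conjMap u (expect G) - expect G) := by
  have hE := isCondExp_expect G
  have hK0 : 0 ≤ Tracial.normInfTwo (trace Γ) (conjMap u (expect G) - expect G) :=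
    (norm_nonneg _).trans (norm_vec_le_normInfTwo (isCondExp_conjMap hE u) hE (x := 0) (by simp))
  have hlim := (tendsto_asymptotic hG (u : VN Γ) (star (u : VN Γ))).norm
  rw [norm_zero] at hlim
  have h := le_of_forall_le_tendsto_zero hlim fun g =>
    (norm_vec_conj_lam_le u g.2).trans (add_le_add_left (pow_le_pow_left₀ (norm_nonneg _)
      (norm_vec_expect_mul_le (u : VN Γ) _ (norm_unitary (star u)) (g : Γ)) 2) _)
  have h1 := norm_vec_expect_sq_add G (u : VN Γ)
  rw [norm_vec_unitary, one_pow] at h1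
  exact (abs_le_of_sq_le_sq' (by linarith) hK0).2

end

end GroupVN

namespace GroupVN

open Filter Topology

theorem norm_le_of_forall_apply_le {Γ : Type*} {ξ η : ℓ²(Γ, ℂ)} (h : ∀ k, ‖ξ k‖ ≤ ‖η k‖) : ‖ξ‖ ≤ ‖η‖ := by
  refine le_of_sq_le_sq ?_ (norm_nonneg _)
  rw [norm_sq_eq, norm_sq_eq]
  refine Summable.tsum_le_tsum (fun k => ?_) (summable_norm_sq _) (summable_norm_sq _)
  gcongr
  exact h k

section

variable {Γ : Type*} [Group Γ]

theorem vec_lam_mul_mul_lam (a b : Γ) (x : VN Γ) (k : Γ) :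
    vec (lam a * x * lam b) k = vec x (a⁻¹ * k * b⁻¹) := by
  rw [mul_assoc, vec_mul, vec_mul, vec_lam, coe_basisVec]
  rfl

variable {G : Subgroup Γ}

theorem exists_notMem_of_icc [Infinite G] (hΓ : IsICC Γ) (hab : ∀ a ∈ G, ∀ b ∈ G, a * b = b * a) :
    ∃ g : Γ, g ∉ G := by
  by_contra! h
  obtain ⟨g, hg⟩ := exists_ne (1 : G)
  refine hΓ g (fun h => hg (Subtype.ext h)) ((Set.finite_singleton (g : Γ)).subset ?_)
  intro k hk
  obtain ⟨c, rfl⟩ := isConj_iff.mp hk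
  rw [Set.mem_singleton_iff, hab c (h c) g (h g), mul_inv_cancel_right]

/-! ### Maximal abelian subalgebras -/

/-- Two uses of the bicommutant: λ_g with g ∈ G commutes with λ(G), hence with y; so y commutes with
λ(G), hence with x. -/
theorem subVN_comm (hab : ∀ a ∈ G, ∀ b ∈ G, a * b = b * a) {x y : VN Γ} (hx : x ∈ subVN G)
    (hy : y ∈ subVN G) : x * y = y * x := by
  have h1 : ∀ g ∈ G, leftRegular g * (y : ℓ²(Γ, ℂ) →L[ℂ] ℓ²(Γ, ℂ)) = y * leftRegular g := by
    intro g hg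
    refine mem_vn_iff_commute.mp hy _ fun k hk => ?_
    rw [leftRegular_mul, leftRegular_mul, hab k hk g hg]
  exact Subtype.ext (mem_vn_iff_commute.mp hx _ h1).symm

/-- The coefficients of x are constant on {g⁻¹kg : g ∈ G}. For k ∉ G this orbit is infinite, since
by malnormality no g ≠ e in G commutes with k; a square-summable function vanishes there. -/
theorem mem_subVN_of_commute [Infinite G]
    (hG : ∀ x : Γ, x ∉ G → G.map (MulAut.conj x).toMonoidHom ⊓ G = ⊥) {x : VN Γ}
    (hx : ∀ g ∈ G, x * lam g = lam g * x) : x ∈ subVN G := by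
  rw [mem_subVN_iff]
  intro k hk
  have hinv : ∀ g : G, vec x ((g : Γ)⁻¹ * k * g) = vec x k := by
    intro g
    have h1 := vec_lam_mul_mul_lam (g : Γ) (g : Γ)⁻¹ x k
    rw [← hx g g.2, mul_assoc, lam_mul, mul_inv_cancel, lam_one, mul_one, inv_inv] at h1
    exact h1.symm
  have hinj : Function.Injective fun g : G => (g : Γ)⁻¹ * k * g := by
    intro g h hgh
    have h1 : k * (g * (h : Γ)⁻¹) * k⁻¹ = g * (h : Γ)⁻¹ := by
      have h2 : k * g = g * ((h : Γ)⁻¹ * k * h) := by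
        have := congrArg (fun z => (g : Γ) * z) hgh
        simpa [mul_assoc] using this
      rw [← mul_assoc, h2]
      group
    have h2 := G.mul_mem g.2 (G.inv_mem h.2)
    exact Subtype.ext (mul_inv_eq_one.mp (eq_one_of_malnormal hG hk h2 (h1.symm ▸ h2)))
  have := apply_eq_zero_of_infinite (vec x) hinj fun g => congrArg norm (hinv g)
  exact norm_eq_zero.mp this

theorem isMasa_subVN [Infinite G]
    (hG : ∀ x : Γ, x ∉ G → G.map (MulAut.conj x).toMonoidHom ⊓ G = ⊥)
    (hab : ∀ a ∈ G, ∀ b ∈ G, a * b = b * a) : Tracial.IsMasa (M := VN Γ) (subVN G) :=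
  ⟨fun _ ha _ hb => subVN_comm hab ha hb, fun _ hB hle x hx =>
    mem_subVN_of_commute hG fun _ hg => hB x hx _ (hle (lam_mem_subVN hg))⟩

/-! ### The invariant `α` -/

/-- Both expectations only delete coordinates of xδ_e, so each coordinate of the difference is 0 or
± the corresponding one of x. This beats the general bound 2. -/
theorem normInfTwo_conj_lam_le (g : Γ) :
    Tracial.normInfTwo (trace Γ) (conjMap ⟨lam g, lam_mem_unitary g⟩ (expect G) - expect G) ≤
      1 := by
  refine csSup_le ⟨_, 0, by simp, rfl⟩ ?_
  rintro _ ⟨x, hx, rfl⟩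
  rw [norm2_eq, LinearMap.sub_apply, conjMap_apply]
  refine le_trans (norm_le_of_forall_apply_le fun k => ?_) ((norm_vec_le x).trans hx)
  have h1 : vec (lam g * expect G (star (lam g) * x * lam g) * star (lam g)) k = 0 ∨
      vec (lam g * expect G (star (lam g) * x * lam g) * star (lam g)) k = vec x k := by
    rw [star_lam, vec_lam_mul_mul_lam, vec_expect_apply, vec_lam_mul_mul_lam]
    split_ifs
    · right
      group
    · left
      rfl
  have h2 : vec (expect G x) k = 0 ∨ vec (expect G x) k = vec x k := by
    rw [vec_expect_apply]
    split_ifs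
    · exact Or.inr rfl
    · exact Or.inl rfl
  rw [map_sub, lp.coeFn_sub, Pi.sub_apply]
  rcases h1 with h1 | h1 <;> rcases h2 with h2 | h2 <;> simp [h1, h2]

theorem isStronglySingularWith_one [Infinite G]
    (hG : ∀ x : Γ, x ∉ G → G.map (MulAut.conj x).toMonoidHom ⊓ G = ⊥) :
    Tracial.IsStronglySingularWith (trace Γ) (subVN G) 1 := by
  intro u
  rw [one_mul, norm2_eq, condExp_eq (isCondExp_expect G),
    condExp_eq (isCondExp_conjMap (isCondExp_expect G) u)]
  exact norm_vec_sub_expect_le hG u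

theorem alpha_subVN [Infinite G] (hΓ : IsICC Γ)
    (hG : ∀ x : Γ, x ∉ G → G.map (MulAut.conj x).toMonoidHom ⊓ G = ⊥)
    (hab : ∀ a ∈ G, ∀ b ∈ G, a * b = b * a) : Tracial.alpha (trace Γ) (subVN G) = 1 := by
  refine IsGreatest.csSup_eq ⟨isStronglySingularWith_one hG, fun c hc => ?_⟩
  obtain ⟨g, hg⟩ := exists_notMem_of_icc hΓ hab
  have h := hc ⟨lam g, lam_mem_unitary g⟩
  rw [norm2_eq, condExp_eq (isCondExp_expect G),
    condExp_eq (isCondExp_conjMap (isCondExp_expect G) _), expect_lam_of_notMem hg, sub_zero,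
    vec_lam, norm_basisVec, mul_one] at h
  exact h.trans (normInfTwo_conj_lam_le g)

/-! ### The invariant `δ` -/

theorem partialIsometry_norm_le_one {v : VN Γ} (hv : v * star v * v = v) : ‖v‖ ≤ 1 := by
  have h1 : ‖star v * v‖ = ‖v‖ * ‖v‖ := CStarRing.norm_star_mul_self
  have h2 : star (star v * v) * (star v * v) = star v * v := by
    rw [star_mul, star_star, mul_assoc, ← mul_assoc v, hv]
  have h3 : ‖star (star v * v) * (star v * v)‖ = ‖star v * v‖ * ‖star v * v‖ :=
    CStarRing.norm_star_mul_self
  rw [h2, h1] at h3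
  by_contra! h
  have h4 : 1 < ‖v‖ * ‖v‖ := one_lt_mul_of_lt_of_le h h.le
  exact h4.ne ((mul_eq_left₀ (zero_lt_one.trans h4).ne').mp h3.symm).symm

theorem norm_vec_partialIsometry_sq {v : VN Γ} (hv : v * star v * v = v) :
    ((‖vec (star v * v)‖ ^ 2 : ℝ) : ℂ) = trace Γ (v * star v) := by
  have h := trace_star_mul (star v * v) (star v * v)
  rw [inner_self_eq_norm_sq_to_K] at h
  rw [Complex.ofReal_pow]
  refine h.symm.trans ?_
  rw [star_mul, star_star, mul_assoc, ← mul_assoc v, hv, trace_mul_comm]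

theorem norm_vec_final_eq {v : VN Γ} (hv : v * star v * v = v) :
    ‖vec (v * star v)‖ = ‖vec (star v * v)‖ := by
  have hv' : star v * star (star v) * star v = star v := by
    have := congrArg star hv
    rwa [star_mul, star_mul, ← mul_assoc] at this
  have h1 := norm_vec_partialIsometry_sq hv
  have h2 := norm_vec_partialIsometry_sq hv'
  rw [star_star, trace_mul_comm, ← h1, Complex.ofReal_inj] at h2
  exact (sq_eq_sq₀ (norm_nonneg _) (norm_nonneg _)).mp h2

/-- Write vav⋆ = (vv⋆)(vav⋆) and use ‖vv⋆‖₂ = ‖v⋆v‖₂. -/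
theorem norm_vec_conj_partialIsometry_le {v : VN Γ} (hv : v * star v * v = v) {a : VN Γ}
    (ha : ‖v * a * star v‖ ≤ 1) :
    ‖vec (v * a * star v - expect G (v * a * star v))‖ ≤ ‖vec (star v * v)‖ := by
  have h0 := norm_vec_expect_sq_add G (v * a * star v)
  have h1 : ‖vec (v * a * star v - expect G (v * a * star v))‖ ≤ ‖vec (v * a * star v)‖ := by
    refine le_of_sq_le_sq ?_ (norm_nonneg _)
    rw [← h0]
    exact le_add_of_nonneg_left (by positivity)
  refine h1.trans ?_
  have h2 : v * a * star v = v * star v * (v * a * star v) := by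
    rw [← mul_assoc, ← mul_assoc, hv]
  rw [h2]
  refine (norm_vec_mul_le_right _ _).trans ?_
  rw [norm_vec_final_eq hv]
  exact mul_le_of_le_one_right (norm_nonneg _) ha

theorem deltaAt_le {v : VN Γ} (hv : v * star v * v = v) :
    Tracial.deltaAt (trace Γ) (subVN G) v ≤ ‖vec (star v * v)‖ := by
  refine csSup_le ⟨_, 0, (subVN G).zero_mem, by simp, rfl⟩ ?_
  rintro _ ⟨a, -, ha, rfl⟩
  rw [norm2_eq, condExp_eq (isCondExp_expect G)]
  exact norm_vec_conj_partialIsometry_le hv ha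

theorem le_deltaAt {v : VN Γ} (hv : v * star v * v = v) {a : VN Γ} (haG : a ∈ subVN G)
    (ha : ‖v * a * star v‖ ≤ 1) :
    ‖vec (v * a * star v - expect G (v * a * star v))‖ ≤
      Tracial.deltaAt (trace Γ) (subVN G) v := by
  refine le_csSup ⟨‖vec (star v * v)‖, ?_⟩
    ⟨a, haG, ha, by rw [norm2_eq, condExp_eq (isCondExp_expect G)]⟩
  rintro _ ⟨a, -, ha, rfl⟩
  rw [norm2_eq, condExp_eq (isCondExp_expect G)]
  exact norm_vec_conj_partialIsometry_le hv ha

/-- With q = vv⋆ and p = v⋆v in the abelian algebra, E(v) = qE(v)p = qpE(v) = 0. -/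
theorem expect_orthogonalIsometry (hab : ∀ a ∈ G, ∀ b ∈ G, a * b = b * a) {v : VN Γ}
    (hv : Tracial.IsOrthogonalIsometryFor (M := VN Γ) (subVN G) v) : expect G v = 0 := by
  have hE := isCondExp_expect G
  have h1 : v * star v * v * (star v * v) = v := by
    rw [hv.partial_isometry, ← mul_assoc, hv.partial_isometry]
  have h2 := hE.bimodule _ hv.final_mem _ hv.initial_mem v
  rw [h1, mul_assoc, subVN_comm hab (hE.mem v) hv.initial_mem, ← mul_assoc, hv.orthogonal,
    zero_mul] at h2
  exact h2

theorem norm_vec_conj_lam_partialIsometry (hab : ∀ a ∈ G, ∀ b ∈ G, a * b = b * a) {v : VN Γ}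
    (hv : Tracial.IsOrthogonalIsometryFor (M := VN Γ) (subVN G) v) {g : Γ} (hg : g ∈ G) :
    ‖vec (v * lam g * star v)‖ = ‖vec (star v * v)‖ := by
  refine (sq_eq_sq₀ (norm_nonneg _) (norm_nonneg _)).mp ?_
  rw [← Complex.ofReal_inj, norm_vec_partialIsometry_sq hv.partial_isometry]
  have h := trace_star_mul (v * lam g * star v) (v * lam g * star v)
  rw [inner_self_eq_norm_sq_to_K] at h
  rw [Complex.ofReal_pow]
  refine h.symm.trans ?_
  congr 1
  calc star (v * lam g * star v) * (v * lam g * star v)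
      = v * star (lam g) * (star v * v * lam g) * star v := by
        simp only [star_mul, star_star, mul_assoc]
    _ = v * (lam g⁻¹ * lam g) * (star v * v) * star v := by
        rw [subVN_comm hab hv.initial_mem (lam_mem_subVN hg), star_lam]
        simp only [mul_assoc]
    _ = v * star v * v * star v := by
        rw [lam_mul, inv_mul_cancel, lam_one, mul_one]
        simp only [mul_assoc]
    _ = v * star v := by rw [hv.partial_isometry]

theorem norm_vec_le_deltaAt [Infinite G]
    (hG : ∀ x : Γ, x ∉ G → G.map (MulAut.conj x).toMonoidHom ⊓ G = ⊥)
    (hab : ∀ a ∈ G, ∀ b ∈ G, a * b = b * a) {v : VN Γ}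
    (hv : Tracial.IsOrthogonalIsometryFor (M := VN Γ) (subVN G) v) :
    ‖vec (star v * v)‖ ≤ Tracial.deltaAt (trace Γ) (subVN G) v := by
  have hv1 := partialIsometry_norm_le_one hv.partial_isometry
  have hv2 : ‖star v‖ ≤ 1 := (norm_star v).trans_le hv1
  have hn : ∀ g : Γ, ‖v * lam g * star v‖ ≤ 1 := fun g => by
    refine (norm_mul_le _ _).trans ?_
    rw [norm_mul_lam]
    exact mul_le_one₀ hv1 (norm_nonneg _) hv2
  have h0 : 0 ≤ Tracial.deltaAt (trace Γ) (subVN G) v :=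
    (norm_nonneg _).trans (le_deltaAt hv.partial_isometry (lam_mem_subVN G.one_mem) (hn 1))
  have hlim := (tendsto_asymptotic hG v (star v)).norm
  rw [norm_zero] at hlim
  have key : ∀ g : G, ‖vec (star v * v)‖ ^ 2 ≤
      ‖vec (expect G (v * lam (g : Γ) * star v))‖ ^ 2 +
        Tracial.deltaAt (trace Γ) (subVN G) v ^ 2 := fun g => by
    rw [← norm_vec_conj_lam_partialIsometry hab hv g.2,
      ← norm_vec_expect_sq_add G (v * lam (g : Γ) * star v)]
    gcongr
    exact le_deltaAt hv.partial_isometry (lam_mem_subVN g.2) (hn g)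
  have h := le_of_forall_le_tendsto_zero hlim fun g =>
    (key g).trans (add_le_add_left (pow_le_pow_left₀ (norm_nonneg _)
      (norm_vec_expect_mul_le v _ hv2 (g : Γ)) 2) _)
  rw [expect_orthogonalIsometry hab hv, map_zero, norm_zero] at h
  exact le_of_sq_le_sq (by linarith) h0

/-- Without an admissible v every real c would qualify and the supremum would be a junk value; hence
the hypothesis `hex`. -/
theorem delta_subVN [Infinite G]
    (hG : ∀ x : Γ, x ∉ G → G.map (MulAut.conj x).toMonoidHom ⊓ G = ⊥)
    (hab : ∀ a ∈ G, ∀ b ∈ G, a * b = b * a)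
    (hex : ∃ v, Tracial.IsOrthogonalIsometryFor (M := VN Γ) (subVN G) v) :
    Tracial.delta (trace Γ) (subVN G) = 1 := by
  refine IsGreatest.csSup_eq ⟨fun v hv => ?_, fun c hc => ?_⟩
  · rw [one_mul, norm2_eq]
    exact norm_vec_le_deltaAt hG hab hv
  · obtain ⟨v, hv⟩ := hex
    have h := (hc v hv).trans (deltaAt_le hv.partial_isometry)
    rw [norm2_eq] at h
    have hpos : 0 < ‖vec (star v * v)‖ := by
      refine norm_pos_iff.mpr fun h0 => hv.ne_zero ?_
      have h1 : star v * v = 0 := vec_injective (h0.trans (map_zero _).symm)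
      exact CStarRing.star_mul_self_eq_zero_iff v |>.mp h1
    nlinarith

end

end GroupVN

/-! ### Extreme points of weakly closed sets of contractions -/

section

open Filter Topology ContinuousLinearMapWOT

variable {H : Type*} [NormedAddCommGroup H] [InnerProductSpace ℂ H] [CompleteSpace H]

/-- Along an ultrafilter the matrix coefficients converge, being bounded; the limits form a bounded
sesquilinear form, whose representing operator is the limit. -/
theorem isCompact_wot_unitBall : IsCompact {A : H →WOT[ℂ] H | ‖toCLM A‖ ≤ 1} := by
  rw [isCompact_iff_ultrafilter_le_nhds]
  intro U hU
  rw [le_principal_iff] at hU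
  have hlim : ∀ v w : H, ∃ c : ℂ,
      Tendsto (fun A : H →WOT[ℂ] H => inner ℂ (A v) w) U (𝓝 c) ∧ ‖c‖ ≤ ‖v‖ * ‖w‖ := by
    intro v w
    have h := isCompact_iff_ultrafilter_le_nhds.mp
      (isCompact_closedBall (0 : ℂ) (‖v‖ * ‖w‖))
      (U.map fun A : H →WOT[ℂ] H => inner ℂ (A v) w) ?_
    · obtain ⟨c, hc, hUc⟩ := h
      exact ⟨c, hUc, by simpa using hc⟩
    · rw [le_principal_iff]
      change ∀ᶠ A in (U : Filter (H →WOT[ℂ] H)), inner ℂ (A v) w ∈ Metric.closedBall (0 : ℂ) _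
      filter_upwards [hU] with A hA
      rw [mem_closedBall_zero_iff]
      refine (norm_inner_le_norm _ _).trans ?_
      gcongr
      exact ((toCLM A).le_of_opNorm_le hA v).trans_eq (one_mul _)
  choose c hc hcn using hlim
  let B : H →L⋆[ℂ] H →L[ℂ] ℂ := LinearMap.mkContinuous₂
    (LinearMap.mk₂'ₛₗ (starRingEnd ℂ) (RingHom.id ℂ) c
      (fun v v' w => tendsto_nhds_unique (hc (v + v') w) (by
        simpa [map_add, inner_add_left] using (hc v w).add (hc v' w)))
      (fun r v w => tendsto_nhds_unique (hc (r • v) w) (by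
        simpa [map_smul, inner_smul_left, mul_comm] using (hc v w).const_mul (starRingEnd ℂ r)))
      (fun v w w' => tendsto_nhds_unique (hc v (w + w')) (by
        simpa [inner_add_right] using (hc v w).add (hc v w')))
      (fun r v w => tendsto_nhds_unique (hc v (r • w)) (by
        simpa [inner_smul_right] using (hc v w).const_mul r))) 1
    (fun v w => by simpa using hcn v w)
  let T : H →L[ℂ] H := InnerProductSpace.continuousLinearMapOfBilin B
  have hT : ∀ v w, inner ℂ (T v) w = c v w := fun v w =>
    InnerProductSpace.continuousLinearMapOfBilin_apply B v w
  refine ⟨ofCLM T, ?_, ?_⟩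
  · refine T.opNorm_le_bound zero_le_one fun v => ?_
    rw [one_mul]
    have h1 := hcn v (T v)
    rw [← hT, inner_self_eq_norm_sq_to_K, norm_pow, RCLike.norm_ofReal, abs_norm, sq] at h1
    by_cases h0 : ‖T v‖ = 0
    · rw [h0]
      positivity
    · exact le_of_mul_le_mul_right h1 (lt_of_le_of_ne (norm_nonneg _) (Ne.symm h0))
  · rw [le_nhds_iff_forall_inner_apply_le_nhds]
    intro x y
    have h1 := (Complex.continuous_conj.tendsto _).comp (hc x y)
    rw [← hT, inner_conj_symm] at h1
    refine Tendsto.congr (fun A => ?_) h1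
    exact inner_conj_symm _ _

/-- This is the existence half of Krein–Milman; v is the midpoint of v + y and v − y. -/
theorem exists_mem_extremePoints_of_wot {S : Set (H →L[ℂ] H)} (hne : S.Nonempty)
    (hS : ∀ x ∈ S, ‖x‖ ≤ 1) (hcl : IsClosed {A : H →WOT[ℂ] H | toCLM A ∈ S}) :
    ∃ v ∈ S, ∀ y, v + y ∈ S → v - y ∈ S → y = 0 := by
  have hc : IsCompact {A : H →WOT[ℂ] H | toCLM A ∈ S} :=
    isCompact_wot_unitBall.of_isClosed_subset hcl fun A hA => hS _ hA
  obtain ⟨x, hx⟩ := hne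
  obtain ⟨A, hA⟩ := hc.extremePoints_nonempty ⟨ofCLM x, hx⟩
  rw [mem_extremePoints_iff_left] at hA
  refine ⟨toCLM A, hA.1, fun y h1 h2 => ?_⟩
  have h := hA.2 (ofCLM (toCLM A + y)) h1 (ofCLM (toCLM A - y)) h2
    ⟨1 / 2, 1 / 2, by norm_num, by norm_num, by norm_num, by
      rw [ofCLM_add, ofCLM_sub, ofCLM_toCLM]
      module⟩
  rw [ofCLM_add, ofCLM_toCLM, add_eq_left] at h
  exact ofCLM_injective h

theorem continuous_wot_mul_mul (S T : H →L[ℂ] H) :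
    Continuous fun A : H →WOT[ℂ] H => ofCLM (S * toCLM A * T) := by
  rw [ContinuousLinearMapWOT.continuous_iff]
  intro x y
  have h : Continuous fun A : H →WOT[ℂ] H => inner ℂ (star S y) (A (T x)) := by fun_prop
  convert h using 2 with A
  rw [ContinuousLinearMap.star_eq_adjoint, ContinuousLinearMap.adjoint_inner_left]
  rfl

theorem isClosed_wot_commute (T : H →L[ℂ] H) :
    IsClosed {A : H →WOT[ℂ] H | T * toCLM A = toCLM A * T} := by
  have h := isClosed_eq (continuous_wot_mul_mul T 1) (continuous_wot_mul_mul 1 T)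
  convert h using 3 with A
  rw [mul_one, one_mul, ofCLM_injective.eq_iff]

theorem isClosed_wot_corner (q p : H →L[ℂ] H) :
    IsClosed {A : H →WOT[ℂ] H | q * toCLM A * p = toCLM A} := by
  have h := isClosed_eq (continuous_wot_mul_mul q p) continuous_id
  convert h using 3 with A
  rw [id, ← toCLM_injective.eq_iff, toCLM_ofCLM]

theorem isClosed_wot_star :
    IsClosed {A : H →WOT[ℂ] H | star (toCLM A) = toCLM A} := by
  have h := isClosed_eq (continuous_star (R := H →WOT[ℂ] H)) continuous_id
  convert h using 3 with A
  rw [id, ← toCLM_injective.eq_iff]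
  rfl

end

/-! ### Perturbations of contractions in a C⋆-algebra -/

section

variable {A : Type*} [CStarAlgebra A] [PartialOrder A] [StarOrderedRing A]

theorem IsSelfAdjoint.le_one_of_norm_le {z : A} (hz : IsSelfAdjoint z) (h : ‖z‖ ≤ 1) : z ≤ 1 := by
  refine (IsSelfAdjoint.le_algebraMap_norm_self hz).trans ?_
  rw [← map_one (algebraMap ℝ A)]
  exact algebraMap_mono A h

theorem norm_le_one_of_star_mul_self_le {x : A} (h : star x * x ≤ 1) : ‖x‖ ≤ 1 := by
  rw [← CStarAlgebra.norm_le_one_iff_of_nonneg _ (star_mul_self_nonneg x),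
    CStarRing.norm_star_mul_self] at h
  by_contra! hx
  nlinarith

theorem star_mul_self_le_one {x : A} (h : ‖x‖ ≤ 1) : star x * x ≤ 1 := by
  rw [← CStarAlgebra.norm_le_one_iff_of_nonneg _ (star_mul_self_nonneg x),
    CStarRing.norm_star_mul_self]
  exact mul_le_one₀ h (norm_nonneg _) h

theorem norm_one_sub_le_one {h : A} (h0 : 0 ≤ h) (h1 : h ≤ 1) : ‖1 - h‖ ≤ 1 := by
  rw [CStarAlgebra.norm_le_one_iff_of_nonneg _ (sub_nonneg.mpr h1)]
  exact sub_le_self _ h0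

/-- With y = s + (1 − s²)b one has 1 − y² = (1 − s²)(1 − z), z = 2sb + (1 − s²)b², a product of
commuting positive elements since ‖z‖ ≤ 1/2 + 1/16. -/
theorem norm_add_one_sub_sq_mul_le_one {s b : A} (hs : IsSelfAdjoint s) (hb : IsSelfAdjoint b)
    (hsb : s * b = b * s) (hs1 : ‖s‖ ≤ 1) (hb1 : ‖b‖ ≤ 1 / 4) :
    ‖s + (1 - s * s) * b‖ ≤ 1 := by
  have hss : s * s ≤ 1 := by simpa [hs.star_eq] using star_mul_self_le_one hs1
  have hss0 : 0 ≤ s * s := hs.mul_self_nonneg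
  have hn := norm_one_sub_le_one hss0 hss
  have hbs' : ∀ t, b * (s * t) = s * (b * t) := fun t => by
    rw [← mul_assoc, ← hsb, mul_assoc]
  have hy : star (s + (1 - s * s) * b) = s + (1 - s * s) * b := by
    simp only [star_add, star_mul, star_sub, hs.star_eq, hb.star_eq, sub_mul, one_mul, mul_assoc,
      ← hsb]
  set z : A := 2 * (s * b) + (1 - s * s) * (b * b) with hz
  have hzs : IsSelfAdjoint z := by
    rw [IsSelfAdjoint, hz]
    simp only [star_add, star_mul, star_sub, hs.star_eq, hb.star_eq, sub_mul, one_mul, mul_assoc,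
      hbs', ← hsb, two_mul]
  have hz1 : ‖z‖ ≤ 1 := by
    have e1 : ‖s * b‖ ≤ 1 * (1 / 4) := (norm_mul_le _ _).trans (by gcongr)
    have e2 : ‖b * b‖ ≤ 1 / 4 * (1 / 4) := (norm_mul_le _ _).trans (by gcongr)
    have e3 : ‖(1 - s * s) * (b * b)‖ ≤ 1 * (1 / 4 * (1 / 4)) :=
      (norm_mul_le _ _).trans (by gcongr)
    rw [hz, two_mul]
    refine (norm_add_le _ _).trans ((add_le_add_left (norm_add_le _ _) _).trans ?_)
    linarith
  refine norm_le_one_of_star_mul_self_le (sub_nonneg.mp ?_)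
  have key : 1 - star (s + (1 - s * s) * b) * (s + (1 - s * s) * b) = (1 - s * s) * (1 - z) := by
    rw [hy, hz]
    simp only [mul_add, add_mul, mul_sub, sub_mul, mul_one, one_mul, mul_assoc, hbs', ← hsb,
      two_mul]
    abel
  rw [key]
  refine Commute.mul_nonneg (sub_nonneg.mpr hss) (sub_nonneg.mpr (hzs.le_one_of_norm_le hz1)) ?_
  rw [commute_iff_eq, hz]
  simp only [mul_add, add_mul, mul_sub, sub_mul, mul_one, one_mul, mul_assoc, hbs', ← hsb,
    two_mul]
  abel

/-- With h = v⋆v the defect 1 − y⋆y of the perturbed element y factors as (1 − h)(1 − z), where z =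
2ch² + c²h³(1 − h) is a contraction for |c| ≤ 1/4. -/
theorem norm_add_smul_mul_le_one {v : A} (hv : ‖v‖ ≤ 1) {c : ℝ} (hc : |c| ≤ 1 / 4) :
    ‖v + c • (v * (star v * v * (1 - star v * v)))‖ ≤ 1 := by
  set h := star v * v with hh
  have hs : star h = h := by rw [hh, star_mul, star_star]
  have h1 : h ≤ 1 := star_mul_self_le_one hv
  have h0 : 0 ≤ h := star_mul_self_nonneg v
  have hn := norm_one_sub_le_one h0 h1
  have hn' : ‖h‖ ≤ 1 := (CStarAlgebra.norm_le_one_iff_of_nonneg h h0).mpr h1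
  set z : A := (2 * c) • (h * h) + c ^ 2 • (h * h * h * (1 - h)) with hz
  have hzs : IsSelfAdjoint z := by
    rw [IsSelfAdjoint, hz]
    simp only [star_add, star_smul, star_mul, star_sub, hs, star_trivial, mul_sub, mul_one,
      mul_assoc]
  have hz1 : ‖z‖ ≤ 1 := by
    have e1 : ‖h * h‖ ≤ 1 := (norm_mul_le _ _).trans (mul_le_one₀ hn' (norm_nonneg _) hn')
    have e2 : ‖h * h * h‖ ≤ 1 := (norm_mul_le _ _).trans (mul_le_one₀ e1 (norm_nonneg _) hn')
    have e3 : ‖h * h * h * (1 - h)‖ ≤ 1 :=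
      (norm_mul_le _ _).trans (mul_le_one₀ e2 (norm_nonneg _) hn)
    rw [hz]
    refine (norm_add_le _ _).trans ?_
    rw [norm_smul, norm_smul, Real.norm_eq_abs, Real.norm_eq_abs, abs_mul, abs_pow, abs_two]
    have e4 : |c| ^ 2 ≤ (1 / 4) ^ 2 := by gcongr
    have e5 : 2 * |c| * ‖h * h‖ ≤ 2 * (1 / 4) * 1 := by gcongr
    have e6 : |c| ^ 2 * ‖h * h * h * (1 - h)‖ ≤ (1 / 4) ^ 2 * 1 := by gcongr
    linarith
  refine norm_le_one_of_star_mul_self_le (sub_nonneg.mp ?_)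
  have key : 1 - star (v + c • (v * (h * (1 - h)))) * (v + c • (v * (h * (1 - h)))) =
      (1 - h) * (1 - z) := by
    have e1 : v + c • (v * (h * (1 - h))) = v * (1 + c • (h * (1 - h))) := by
      rw [mul_add, mul_one, mul_smul_comm]
    have e2 : star (1 + c • (h * (1 - h))) = 1 + c • (h * (1 - h)) := by
      simp only [star_add, star_smul, star_mul, star_sub, star_one, hs, star_trivial, mul_sub,
        mul_one]
    rw [e1, star_mul, e2, mul_assoc, ← mul_assoc (star v), ← hh, hz]
    simp only [mul_add, add_mul, mul_sub, sub_mul, smul_mul_assoc, mul_smul_comm, smul_add,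
      smul_sub, mul_one, one_mul, ← mul_assoc]
    module
  rw [key]
  refine Commute.mul_nonneg (sub_nonneg.mpr h1) (sub_nonneg.mpr (hzs.le_one_of_norm_le hz1)) ?_
  rw [commute_iff_eq, hz]
  simp only [mul_add, add_mul, mul_sub, sub_mul, smul_mul_assoc, mul_smul_comm, smul_sub,
    mul_one, one_mul, ← mul_assoc]
  abel

/-- The cross terms vanish, and w⋆w = f⋆(w⋆w)f ≤ f⋆f = f. -/
theorem norm_add_le_one_of_orthogonal {v w f : A} (hvw : star v * w = 0) (hwf : w * f = w)
    (hf : star f * f = f) (hw : ‖w‖ ≤ 1) (hvf : star v * v + f ≤ 1) : ‖v + w‖ ≤ 1 := by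
  have hwv : star w * v = 0 := by simpa using congrArg star hvw
  refine norm_le_one_of_star_mul_self_le ?_
  have h1 : star (v + w) * (v + w) = star v * v + star f * (star w * w) * f := by
    have : star f * (star w * w) * f = star w * w := by
      rw [← mul_assoc, ← star_mul, mul_assoc, hwf]
    rw [this, star_add, add_mul, mul_add, mul_add, hvw, hwv, add_zero, zero_add]
  rw [h1]
  refine le_trans (add_le_add_right ?_ _) hvf
  have := star_left_conjugate_le_conjugate (star_mul_self_le_one hw) f
  rwa [mul_one, hf] at this

end

namespace GroupVN

open Filter Topology ContinuousLinearMapWOT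

/-! ### Extreme points inside `VN(Γ)` -/

section

variable {Γ : Type*} [Group Γ]

theorem exists_extreme_point {S : Set (VN Γ)} (hne : S.Nonempty) (hS : ∀ x ∈ S, ‖x‖ ≤ 1)
    (hcl : IsClosed {A : ℓ²(Γ, ℂ) →WOT[ℂ] ℓ²(Γ, ℂ) | ∃ x ∈ S,
      (x : ℓ²(Γ, ℂ) →L[ℂ] ℓ²(Γ, ℂ)) = toCLM A}) :
    ∃ v ∈ S, ∀ y, v + y ∈ S → v - y ∈ S → y = 0 := by
  obtain ⟨_, ⟨v, hv, rfl⟩, h⟩ := exists_mem_extremePoints_of_wot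
    (S := (Subtype.val : VN Γ → ℓ²(Γ, ℂ) →L[ℂ] ℓ²(Γ, ℂ)) '' S) (hne.image _)
    (by rintro _ ⟨x, hx, rfl⟩; exact hS x hx) hcl
  exact ⟨v, hv, fun y h1 h2 => Subtype.ext (h y ⟨v + y, h1, rfl⟩ ⟨v - y, h2, rfl⟩)⟩

theorem isClosed_wot_vn (G : Subgroup Γ) :
    IsClosed {A : ℓ²(Γ, ℂ) →WOT[ℂ] ℓ²(Γ, ℂ) | toCLM A ∈ (vn G).toStarSubalgebra} := by
  simp only [mem_vn_iff_commute, Set.ofPred_forall]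
  exact isClosed_iInter fun T => isClosed_iInter fun _ => isClosed_wot_commute T

theorem trace_star (x : VN Γ) : trace Γ (star x) = star (trace Γ x) := by
  rw [trace_apply, trace_apply, vec_star_apply, inv_one]

theorem eq_zero_of_smul_eq_zero {c : ℂ} (hc : c ≠ 0) {x : VN Γ} (h : c • x = 0) : x = 0 := by
  have h1 := congrArg norm h
  rw [norm_smul, norm_zero] at h1
  exact norm_eq_zero.mp ((mul_eq_zero.mp h1).resolve_left (norm_ne_zero_iff.mpr hc))

theorem trace_one : trace Γ 1 = 1 := by
  rw [trace_apply, ← lam_one, vec_lam, basisVec_apply_self]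

variable {G : Subgroup Γ}

theorem exists_extreme_selfAdjoint (G : Subgroup Γ) :
    ∃ s ∈ subVN G, star s = s ∧ ‖s‖ ≤ 1 ∧ trace Γ s = 0 ∧
      ∀ y ∈ subVN G, star y = y → trace Γ y = 0 → ‖s + y‖ ≤ 1 → ‖s - y‖ ≤ 1 → y = 0 := by
  obtain ⟨s, ⟨h1, h2, h3, h4⟩, h⟩ := exists_extreme_point
    (S := {x : VN Γ | x ∈ subVN G ∧ star x = x ∧ ‖x‖ ≤ 1 ∧ trace Γ x = 0})
    ⟨0, (subVN G).zero_mem, star_zero _, by simp, map_zero _⟩ (fun x hx => hx.2.2.1) (by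
      have hc := (((isClosed_wot_vn G).inter isClosed_wot_star).inter
        (isCompact_wot_unitBall (H := ℓ²(Γ, ℂ))).isClosed).inter
        (isClosed_eq (f := fun A : ℓ²(Γ, ℂ) →WOT[ℂ] ℓ²(Γ, ℂ) =>
          inner ℂ (basisVec (1 : Γ)) (A (basisVec 1))) (g := fun _ => 0) (by fun_prop)
          continuous_const)
      convert hc using 1
      ext A
      constructor
      · rintro ⟨x, ⟨h1, h2, h3, h4⟩, hx⟩
        refine ⟨⟨⟨?_, ?_⟩, ?_⟩, ?_⟩
        · change toCLM A ∈ (vn G).toStarSubalgebra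
          rw [← hx]
          exact h1
        · change star (toCLM A) = toCLM A
          rw [← hx]
          exact congrArg Subtype.val h2
        · change ‖toCLM A‖ ≤ 1
          rw [← hx]
          exact h3
        · change inner ℂ (basisVec (1 : Γ)) (toCLM A (basisVec 1)) = 0
          rw [← hx]
          exact h4
      · rintro ⟨⟨⟨h1, h2⟩, h3⟩, h4⟩
        exact ⟨⟨toCLM A, vn_mono le_top h1⟩, ⟨h1, Subtype.ext h2, h3, h4⟩, rfl⟩)
  refine ⟨s, h1, h2, h3, h4, fun y e1 e2 e3 e4 e5 => h y ?_ ?_⟩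
  · exact ⟨add_mem h1 e1, by rw [star_add, h2, e2], e4, by rw [map_add, h4, e3, add_zero]⟩
  · exact ⟨sub_mem h1 e1, by rw [star_sub, h2, e2], e5, by rw [map_sub, h4, e3, sub_zero]⟩

theorem exists_extreme_corner (q p : VN Γ) :
    ∃ v : VN Γ, q * v * p = v ∧ ‖v‖ ≤ 1 ∧
      ∀ y, q * y * p = y → ‖v + y‖ ≤ 1 → ‖v - y‖ ≤ 1 → y = 0 := by
  obtain ⟨v, ⟨h1, h2⟩, h⟩ := exists_extreme_point
    (S := {x : VN Γ | q * x * p = x ∧ ‖x‖ ≤ 1})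
    ⟨0, by simp, by simp⟩ (fun x hx => hx.2) (by
      have hc := ((isClosed_wot_vn (⊤ : Subgroup Γ)).inter (isClosed_wot_corner
        (q : ℓ²(Γ, ℂ) →L[ℂ] ℓ²(Γ, ℂ)) (p : ℓ²(Γ, ℂ) →L[ℂ] ℓ²(Γ, ℂ)))).inter
        (isCompact_wot_unitBall (H := ℓ²(Γ, ℂ))).isClosed
      convert hc using 1
      ext A
      constructor
      · rintro ⟨x, ⟨h1, h2⟩, hx⟩
        refine ⟨⟨?_, ?_⟩, ?_⟩
        · change toCLM A ∈ (vn (⊤ : Subgroup Γ)).toStarSubalgebra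
          rw [← hx]
          exact x.2
        · change (q : ℓ²(Γ, ℂ) →L[ℂ] ℓ²(Γ, ℂ)) * toCLM A * p = toCLM A
          rw [← hx]
          exact congrArg Subtype.val h1
        · change ‖toCLM A‖ ≤ 1
          rw [← hx]
          exact h2
      · rintro ⟨⟨h1, h2⟩, h3⟩
        exact ⟨⟨toCLM A, h1⟩, ⟨Subtype.ext h2, h3⟩, rfl⟩)
  refine ⟨v, h1, h2, fun y e1 e4 e5 => h y ⟨?_, e4⟩ ⟨?_, e5⟩⟩
  · rw [mul_add, add_mul, h1, e1]
  · rw [mul_sub, sub_mul, h1, e1]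

/-! ### A symmetry of trace zero in a diffuse abelian subalgebra -/

theorem norm_add_mul_le_one {s b : VN Γ} (hs : star s = s) (hb : star b = b)
    (hsb : s * b = b * s) (hs1 : ‖s‖ ≤ 1) (hb1 : ‖b‖ ≤ 1 / 4) : ‖s + (1 - s * s) * b‖ ≤ 1 :=
  norm_add_one_sub_sq_mul_le_one (A := ℓ²(Γ, ℂ) →L[ℂ] ℓ²(Γ, ℂ)) (congrArg Subtype.val hs)
    (congrArg Subtype.val hb) (congrArg Subtype.val hsb) hs1 hb1

/-- The extremality property of a self-adjoint contraction of trace zero in `VN(G)`. -/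
def IsExtremeSelfAdjoint (G : Subgroup Γ) (s : VN Γ) : Prop :=
  ∀ y ∈ subVN G, star y = y → trace Γ y = 0 → ‖s + y‖ ≤ 1 → ‖s - y‖ ≤ 1 → y = 0

/-- After scaling b to norm at most 1/4, both s ± (1 − s²)b are admissible contractions, so
extremality kills the perturbation. -/
theorem IsExtremeSelfAdjoint.mul_eq_zero_of_selfAdjoint
    (hab : ∀ a ∈ G, ∀ b ∈ G, a * b = b * a) {s : VN Γ} (hsG : s ∈ subVN G) (hs : star s = s)
    (hs1 : ‖s‖ ≤ 1) (hext : IsExtremeSelfAdjoint G s) {b : VN Γ} (hbG : b ∈ subVN G)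
    (hb : star b = b) (htr : trace Γ ((1 - s * s) * b) = 0) : (1 - s * s) * b = 0 := by
  have hhG : 1 - s * s ∈ subVN G := sub_mem (one_mem _) (mul_mem hsG hsG)
  have hh : star (1 - s * s) = 1 - s * s := by rw [star_sub, star_mul, hs, star_one]
  set c : ℝ := 1 / 4 / (‖b‖ + 1) with hc
  have hc0 : 0 < c := by positivity
  have hcb : ‖(c : ℂ) • b‖ ≤ 1 / 4 := by
    rw [norm_smul, Complex.norm_real, Real.norm_of_nonneg hc0.le, hc, div_mul_eq_mul_div,
      div_le_iff₀ (by positivity)]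
    linarith [norm_nonneg b]
  have hcG : (c : ℂ) • b ∈ subVN G := (subVN G).smul_mem hbG _
  have hcs : star ((c : ℂ) • b) = (c : ℂ) • b := by
    rw [star_smul, hb, RCLike.star_def, Complex.conj_ofReal]
  have h1 := norm_add_mul_le_one hs hcs (subVN_comm hab hsG hcG) hs1 hcb
  have h2 := norm_add_mul_le_one (b := -((c : ℂ) • b)) hs (by rw [star_neg, hcs])
    (subVN_comm hab hsG (neg_mem hcG)) hs1 (by rwa [norm_neg])
  rw [mul_neg, ← sub_eq_add_neg] at h2
  have h3 := hext _ (mul_mem hhG hcG) (by rw [star_mul, hcs, hh, subVN_comm hab hcG hhG])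
    (by rw [mul_smul_comm, map_smul, htr, smul_zero]) h1 h2
  rw [mul_smul_comm] at h3
  exact eq_zero_of_smul_eq_zero (Complex.ofReal_ne_zero.mpr hc0.ne') h3

theorem IsExtremeSelfAdjoint.mul_eq_zero
    (hab : ∀ a ∈ G, ∀ b ∈ G, a * b = b * a) {s : VN Γ} (hsG : s ∈ subVN G) (hs : star s = s)
    (hs1 : ‖s‖ ≤ 1) (hext : IsExtremeSelfAdjoint G s) {b : VN Γ} (hbG : b ∈ subVN G)
    (htr : trace Γ ((1 - s * s) * b) = 0) : (1 - s * s) * b = 0 := by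
  have hhG : 1 - s * s ∈ subVN G := sub_mem (one_mem _) (mul_mem hsG hsG)
  have hh : star (1 - s * s) = 1 - s * s := by rw [star_sub, star_mul, hs, star_one]
  have hbG' : star b ∈ subVN G := star_mem hbG
  have htr' : trace Γ ((1 - s * s) * star b) = 0 := by
    have h1 : star b * (1 - s * s) = star ((1 - s * s) * b) := by rw [star_mul, hh]
    rw [subVN_comm hab hhG hbG', h1, trace_star, htr, star_zero]
  have h1 := hext.mul_eq_zero_of_selfAdjoint hab hsG hs hs1 (b := b + star b) (add_mem hbG hbG')
    (by rw [star_add, star_star, add_comm]) (by rw [mul_add, map_add, htr, htr', add_zero])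
  have h2 := hext.mul_eq_zero_of_selfAdjoint hab hsG hs hs1 (b := Complex.I • (b - star b))
    ((subVN G).smul_mem (sub_mem hbG hbG') _)
    (by
      rw [star_smul, star_sub, star_star, RCLike.star_def, Complex.conj_I, neg_smul, ← smul_neg,
        neg_sub])
    (by rw [mul_smul_comm, map_smul, mul_sub, map_sub, htr, htr', sub_zero, smul_zero])
  rw [mul_smul_comm] at h2
  have h3 := eq_zero_of_smul_eq_zero Complex.I_ne_zero h2
  rw [mul_sub, sub_eq_zero] at h3
  rw [mul_add, ← h3, ← two_smul ℂ] at h1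
  exact eq_zero_of_smul_eq_zero two_ne_zero h1

theorem norm_vec_inv_of_mul_lam_eq_smul {h : VN Γ} (h0 : h ≠ 0) {c : ℂ} {g : Γ}
    (hg : h * lam g = c • h) : ‖vec h g⁻¹‖ = ‖trace Γ h‖ := by
  have hc1 : ‖c‖ = 1 := by
    have h2 := congrArg norm hg
    rw [norm_mul_lam, norm_smul] at h2
    exact (mul_eq_right₀ (norm_ne_zero_iff.mpr h0)).mp h2.symm
  have h2 := vec_lam_mul_mul_lam 1 g h 1
  rw [lam_one, one_mul, hg, inv_one, one_mul, one_mul, map_smul] at h2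
  rw [← h2, lp.coeFn_smul, Pi.smul_apply, norm_smul, hc1, one_mul, trace_apply]

/-- If `G` is infinite and abelian, then `VN(G)` contains a self-adjoint unitary of trace zero. -/
theorem exists_symmetry [Infinite G] (hab : ∀ a ∈ G, ∀ b ∈ G, a * b = b * a) :
    ∃ s ∈ subVN G, star s = s ∧ s * s = 1 ∧ trace Γ s = 0 := by
  obtain ⟨s, hsG, hs, hs1, hs0, hext⟩ := exists_extreme_selfAdjoint G
  refine ⟨s, hsG, hs, ?_, hs0⟩
  have claim : ∀ b ∈ subVN G, trace Γ ((1 - s * s) * b) = 0 → (1 - s * s) * b = 0 :=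
    fun b hb => IsExtremeSelfAdjoint.mul_eq_zero hab hsG hs hs1 hext hb
  by_contra hne
  have hh0 : 1 - s * s ≠ 0 := fun h => hne (sub_eq_zero.mp h).symm
  generalize 1 - s * s = h at claim hh0
  have htr : trace Γ h ≠ 0 := fun h0 => hh0 (by
    have := claim 1 (one_mem _) (by rwa [mul_one])
    rwa [mul_one] at this)
  -- By `claim`, h`VN(G)` is one-dimensional, so hλ_g is a scalar multiple of h. The coefficients of
  -- h then have constant modulus |τ(h)| on the infinite set G, contradicting τ(h) ≠ 0.
  have hconst : ∀ g : G, ‖vec h (g : Γ)⁻¹‖ = ‖trace Γ h‖ := by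
    intro g
    refine norm_vec_inv_of_mul_lam_eq_smul (c := trace Γ (h * lam (g : Γ)) / trace Γ h) hh0 ?_
    generalize hc : trace Γ (h * lam (g : Γ)) / trace Γ h = c
    have hc' : trace Γ (h * lam (g : Γ)) = c * trace Γ h := by rw [← hc, div_mul_cancel₀ _ htr]
    have h1 := claim (lam (g : Γ) - c • 1)
      (sub_mem (lam_mem_subVN g.2) ((subVN G).smul_mem (one_mem _) _)) (by
        rw [mul_sub, map_sub, mul_smul_comm, map_smul, mul_one, hc', smul_eq_mul, sub_self])
    rwa [mul_sub, mul_smul_comm, mul_one, sub_eq_zero] at h1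
  have h0 := apply_eq_zero_of_infinite (vec h)
    (e := fun g : G => (g : Γ)⁻¹) (fun g h hgh => Subtype.ext (inv_injective hgh)) hconst
  exact htr (norm_eq_zero.mp h0)

end

end GroupVN

/-- The parallelogram law forces uniqueness. Uniqueness is what makes the minimal vector invariant
under isometries preserving K. -/
theorem exists_unique_minimal_norm {E : Type*} [NormedAddCommGroup E] [InnerProductSpace ℂ E]
    [CompleteSpace E] {K : Set E} (hne : K.Nonempty) (hcl : IsClosed K)
    (hconv : ∀ x ∈ K, ∀ y ∈ K, ∀ a b : ℝ, 0 ≤ a → 0 ≤ b → a + b = 1 →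
      (a : ℂ) • x + (b : ℂ) • y ∈ K) :
    ∃ v ∈ K, ∀ w ∈ K, ‖w‖ ≤ ‖v‖ → w = v := by
  let _ := InnerProductSpace.rclikeToReal ℂ E
  obtain ⟨v, hv, hmin⟩ := exists_norm_eq_iInf_of_complete_convex hne hcl.isComplete
    (fun x hx y hy a b ha hb hab => hconv x hx y hy a b ha hb hab) 0
  refine ⟨v, hv, fun w hw hwv => ?_⟩
  have hle : ∀ z ∈ K, ‖v‖ ≤ ‖z‖ := by
    intro z hz
    rw [zero_sub, norm_neg] at hmin
    rw [hmin]
    refine (ciInf_le ⟨0, ?_⟩ (⟨z, hz⟩ : K)).trans_eq (by rw [zero_sub, norm_neg])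
    rintro _ ⟨w, rfl⟩
    exact norm_nonneg _
  have h1 := hle _ (hconv w hw v hv (1 / 2) (1 / 2) (by norm_num) (by norm_num) (by norm_num))
  rw [← smul_add, norm_smul, Complex.norm_real, Real.norm_of_nonneg (by norm_num)] at h1
  have h2 := parallelogram_law_with_norm ℂ w v
  have h3 : ‖w - v‖ ^ 2 ≤ 0 := by nlinarith [norm_nonneg v, norm_nonneg w, norm_nonneg (w + v)]
  rw [← sub_eq_zero, ← norm_eq_zero]
  exact pow_eq_zero_iff two_ne_zero |>.mp (le_antisymm h3 (sq_nonneg _))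

namespace GroupVN

theorem ofReal_smul_vec {Γ : Type*} (a : ℝ) (ξ : ℓ²(Γ, ℂ)) : (a : ℂ) • ξ = a • ξ := by
  ext k
  rw [lp.coeFn_smul, lp.coeFn_smul, Pi.smul_apply, Pi.smul_apply, Complex.coe_smul]

section

variable {Γ : Type*} [Group Γ]

/-! ### Factoriality for i.c.c. groups -/

/-- The unitary of `ℓ²(Γ)` implementing the inner automorphism of `Γ` given by `g`. -/
noncomputable def adjointRegular (g : Γ) : ℓ²(Γ, ℂ) →L[ℂ] ℓ²(Γ, ℂ) :=
  leftRegular g * rightRegular g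

theorem adjointRegular_apply (g : Γ) (ξ : ℓ²(Γ, ℂ)) (k : Γ) :
    adjointRegular g ξ k = ξ (g⁻¹ * k * g) := rfl

theorem norm_adjointRegular (g : Γ) (ξ : ℓ²(Γ, ℂ)) : ‖adjointRegular g ξ‖ = ‖ξ‖ :=
  (norm_leftRegular_apply g _).trans (norm_rightRegular_apply g ξ)

theorem adjointRegular_mul (g h : Γ) (ξ : ℓ²(Γ, ℂ)) :
    adjointRegular g (adjointRegular h ξ) = adjointRegular (g * h) ξ := by
  ext k
  simp only [adjointRegular_apply, mul_inv_rev, mul_assoc]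

theorem apply_eq_zero_of_conj_invariant (hΓ : IsICC Γ) {ξ : ℓ²(Γ, ℂ)}
    (hξ : ∀ g, adjointRegular g ξ = ξ) {k : Γ} (hk : k ≠ 1) : ξ k = 0 := by
  have : Infinite (conjugatesOf k) := (hΓ k hk).to_subtype
  refine norm_eq_zero.mp (apply_eq_zero_of_infinite ξ (e := fun l : conjugatesOf k => (l : Γ))
    Subtype.val_injective fun l => ?_)
  obtain ⟨c, hc⟩ := isConj_iff.mp l.2
  rw [← hc, ← hξ c, adjointRegular_apply, hξ c]
  congr 2
  group

/-- Conjugation acts isometrically and preserves the closed convex hull of the orbit, so it fixes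
the unique vector of least norm. -/
theorem exists_conj_invariant (ξ : ℓ²(Γ, ℂ)) :
    ∃ ζ ∈ closure (convexHull ℝ (Set.range fun g : Γ => adjointRegular g ξ)),
      ∀ g, adjointRegular g ζ = ζ := by
  set K := closure (convexHull ℝ (Set.range fun g : Γ => adjointRegular g ξ)) with hK
  have hconv : Convex ℝ K := (convex_convexHull ℝ _).closure
  have hmem : ∀ g, adjointRegular g ξ ∈ K := fun g =>
    subset_closure (subset_convexHull ℝ _ ⟨g, rfl⟩)
  obtain ⟨ζ, hζ, hmin⟩ := exists_unique_minimal_norm ⟨_, hmem 1⟩ isClosed_closure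
    fun x hx y hy a b ha hb hab => by
      have := hconv hx hy ha hb hab
      rwa [← ofReal_smul_vec, ← ofReal_smul_vec] at this
  refine ⟨ζ, hζ, fun g => hmin _ ?_ (norm_adjointRegular g ζ).le⟩
  have hsub : K ⊆ adjointRegular g ⁻¹' K := by
    refine closure_minimal (convexHull_min ?_ ?_)
      (isClosed_closure.preimage (adjointRegular g).continuous)
    · rintro _ ⟨h, rfl⟩
      rw [Set.mem_preimage, adjointRegular_mul]
      exact hmem _
    · intro x hx y hy a b ha hb hab
      have := hconv hx hy ha hb hab
      rw [← ofReal_smul_vec, ← ofReal_smul_vec] at this ⊢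
      rwa [Set.mem_preimage, map_add, map_smul, map_smul]
  exact hsub hζ

theorem inner_eq_of_mem_closure_convexHull {ξ η ζ : ℓ²(Γ, ℂ)} {c : ℂ}
    (h : ∀ g, inner ℂ η (adjointRegular g ξ) = c)
    (hζ : ζ ∈ closure (convexHull ℝ (Set.range fun g : Γ => adjointRegular g ξ))) :
    inner ℂ η ζ = c := by
  have hsub : closure (convexHull ℝ (Set.range fun g : Γ => adjointRegular g ξ)) ⊆
      {ζ | inner ℂ η ζ = c} := by
    refine closure_minimal (convexHull_min ?_ ?_) (isClosed_eq (by fun_prop) continuous_const)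
    · rintro _ ⟨g, rfl⟩
      exact h g
    · intro x hx y hy a b ha hb hab
      rw [Set.mem_ofPred_eq] at *
      rw [← ofReal_smul_vec, ← ofReal_smul_vec, inner_add_right, inner_smul_right,
        inner_smul_right, hx, hy, ← add_mul, ← Complex.ofReal_add, hab, Complex.ofReal_one,
        one_mul]
  exact hsub hζ

theorem inner_vec_star (e x : VN Γ) : inner ℂ (vec (star e)) (vec x) = trace Γ (e * x) := by
  rw [← trace_star_mul, star_star]

/-- A weak form of factoriality: corners of `VN(Γ)` are non-zero. -/
theorem trace_mul_trace_eq_zero (hΓ : IsICC Γ) {e f : VN Γ} (h : ∀ y, e * y * f = 0) :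
    trace Γ e * trace Γ f = 0 := by
  -- Averaging f over conjugation gives ζ = τ(f)δ_e by i.c.c. Each conjugate of f is annihilated by
  -- e on the left, so pairing ζ with e⋆δ_e yields both 0 and τ(e)τ(f).
  obtain ⟨ζ, hζ, hinv⟩ := exists_conj_invariant (vec f)
  have h1 : inner ℂ (basisVec 1) ζ = trace Γ f := by
    refine inner_eq_of_mem_closure_convexHull (fun g => ?_) hζ
    rw [inner_basisVec, adjointRegular_apply, trace_apply]
    group
  have h2 : inner ℂ (vec (star e)) ζ = 0 := by
    refine inner_eq_of_mem_closure_convexHull (fun g => ?_) hζ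
    have hg : adjointRegular g (vec f) = vec (lam g * f * lam g⁻¹) := by
      ext k
      rw [vec_lam_mul_mul_lam, inv_inv, adjointRegular_apply]
    rw [hg, inner_vec_star, ← mul_assoc, ← mul_assoc, h, zero_mul, map_zero]
  have h3 : ζ = trace Γ f • basisVec 1 := by
    ext k
    by_cases hk : k = 1
    · rw [hk, ← h1, inner_basisVec, lp.coeFn_smul, Pi.smul_apply, basisVec_apply_self, smul_eq_mul,
        mul_one]
    · rw [apply_eq_zero_of_conj_invariant hΓ hinv hk, lp.coeFn_smul, Pi.smul_apply,
        basisVec_apply_ne hk, smul_zero]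
  have h4 := inner_vec_star e (lam 1)
  rw [lam_one, mul_one, ← lam_one, vec_lam] at h4
  rw [h3, inner_smul_right, h4] at h2
  rw [mul_comm]
  exact h2

/-! ### Equivalence of projections of equal trace -/

theorem vn_norm_add_smul_mul_le_one {v : VN Γ} (hv : ‖v‖ ≤ 1) {c : ℝ} (hc : |c| ≤ 1 / 4) :
    ‖v + (c : ℂ) • (v * (star v * v * (1 - star v * v)))‖ ≤ 1 := by
  have h := norm_add_smul_mul_le_one (A := ℓ²(Γ, ℂ) →L[ℂ] ℓ²(Γ, ℂ))
    (v := (v : ℓ²(Γ, ℂ) →L[ℂ] ℓ²(Γ, ℂ))) hv hc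
  rw [← Complex.coe_smul] at h
  exact h

theorem vn_norm_add_le_one {v w f : VN Γ} (hvw : star v * w = 0) (hwf : w * f = w)
    (hf : star f * f = f) (hw : ‖w‖ ≤ 1) {p : VN Γ} (hvf : star v * v + f = p)
    (hp : star p = p) (hp' : p * p = p) : ‖v + w‖ ≤ 1 := by
  refine norm_add_le_one_of_orthogonal (A := ℓ²(Γ, ℂ) →L[ℂ] ℓ²(Γ, ℂ))
    (congrArg Subtype.val hvw) (congrArg Subtype.val hwf) (congrArg Subtype.val hf) hw ?_
  have h1 : (star (v : ℓ²(Γ, ℂ) →L[ℂ] ℓ²(Γ, ℂ)) * v + f : ℓ²(Γ, ℂ) →L[ℂ] ℓ²(Γ, ℂ)) = p :=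
    congrArg Subtype.val hvf
  have h2 : IsStarProjection (p : ℓ²(Γ, ℂ) →L[ℂ] ℓ²(Γ, ℂ)) :=
    ⟨congrArg Subtype.val hp', congrArg Subtype.val hp⟩
  rw [h1]
  exact h2.le_one

end

end GroupVN

namespace GroupVN

/-! ### Partial isometries from extreme points of a corner -/

section

variable {Γ : Type*} [Group Γ]

theorem eq_zero_of_star_mul_self {x : VN Γ} (h : star x * x = 0) : x = 0 :=
  CStarRing.star_mul_self_eq_zero_iff x |>.mp h

theorem eq_zero_of_trace_eq_zero {e : VN Γ} (he : star e = e) (he' : e * e = e)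
    (h : trace Γ e = 0) : e = 0 := by
  have h1 := trace_star_mul e e
  rw [he, he', h] at h1
  exact vec_injective ((inner_self_eq_zero.mp h1.symm).trans (map_zero _).symm)

/-- The extremality property of a contraction of the corner `q VN(Γ) p`. -/
def IsExtremeIn (q p v : VN Γ) : Prop :=
  ∀ y, q * y * p = y → ‖v + y‖ ≤ 1 → ‖v - y‖ ≤ 1 → y = 0

/-- With h = v⋆v, both v ± ¼vh(1 − h) are contractions in the corner, so vh(1 − h) = 0; this forces
h to be a projection with vh = v. -/
theorem IsExtremeIn.partial_isometry {q p v : VN Γ} (hext : IsExtremeIn q p v) (hv : ‖v‖ ≤ 1)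
    (hqv : q * v = v) (hvp : v * p = v) : v * star v * v = v := by
  generalize hh : star v * v = h
  have hs : star h = h := by rw [← hh, star_mul, star_star]
  have hhp : h * p = h := by rw [← hh, mul_assoc, hvp]
  have h1 : v * (h * (1 - h)) = 0 := by
    have e1 := vn_norm_add_smul_mul_le_one hv (c := 1 / 4) (by norm_num [abs_of_pos])
    have e2 := vn_norm_add_smul_mul_le_one hv (c := -(1 / 4)) (by norm_num [abs_of_pos])
    rw [hh] at e1 e2
    rw [Complex.ofReal_neg, neg_smul, ← sub_eq_add_neg] at e2
    refine eq_zero_of_smul_eq_zero (c := ((1 / 4 : ℝ) : ℂ)) (by norm_num) (hext _ ?_ e1 e2)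
    rw [mul_smul_comm, smul_mul_assoc, ← mul_assoc q, hqv]
    congr 1
    rw [mul_assoc v, mul_assoc h, sub_mul, one_mul, mul_sub, hhp, mul_sub h, mul_one]
  have h2 : h * (h * (1 - h)) = 0 := by
    rw [← hh, mul_assoc, hh, h1, mul_zero]
  have h3 : h * (1 - h) = 0 := by
    refine eq_zero_of_star_mul_self ?_
    rw [star_mul, star_sub, star_one, hs, mul_assoc, h2, mul_zero]
  have h4 : h * h = h := by
    rw [mul_sub, mul_one, sub_eq_zero] at h3
    exact h3.symm
  have h5 : v - v * h = 0 := by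
    refine eq_zero_of_star_mul_self ?_
    rw [star_sub, star_mul, hs, sub_mul, mul_sub, mul_sub, ← mul_assoc (star v), hh,
      mul_assoc h (star v), hh, mul_assoc h (star v), ← mul_assoc (star v), hh, h4, h4, sub_self]
  rw [mul_assoc, hh]
  exact (sub_eq_zero.mp h5).symm

/-- A small multiple w of eyf has range orthogonal to that of v, and is supported on f, the
complement of v⋆v in p. So v ± w are contractions in the corner. -/
theorem IsExtremeIn.mul_mul_eq_zero {q p v e f : VN Γ} (hext : IsExtremeIn q p v)
    (hp : star p = p) (hp' : p * p = p) (hqe : q * e = e) (hve : star v * e = 0)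
    (hfs : star f = f) (hff : f * f = f) (hfp : f * p = f) (hsum : star v * v + f = p)
    (y : VN Γ) : e * y * f = 0 := by
  set c : ℝ := 1 / (‖e * y * f‖ + 1) with hc
  have hc0 : 0 < c := by positivity
  have hcw : ‖(c : ℂ) • (e * y * f)‖ ≤ 1 := by
    rw [norm_smul, Complex.norm_real, Real.norm_of_nonneg hc0.le, hc, div_mul_eq_mul_div,
      div_le_one (by positivity)]
    linarith
  have hvw : star v * (e * y * f) = 0 := by
    rw [← mul_assoc, ← mul_assoc, hve, zero_mul, zero_mul]
  have hwf : e * y * f * f = e * y * f := by rw [mul_assoc, hff]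
  have hqwp : q * (e * y * f) * p = e * y * f := by
    rw [mul_assoc q, mul_assoc (e * y), hfp, ← mul_assoc q, ← mul_assoc q, hqe]
  generalize e * y * f = w at *
  have hvw' : star v * ((c : ℂ) • w) = 0 := by rw [mul_smul_comm, hvw, smul_zero]
  have hwf' : ((c : ℂ) • w) * f = (c : ℂ) • w := by rw [smul_mul_assoc, hwf]
  have hf : star f * f = f := by rw [hfs, hff]
  have e1 := vn_norm_add_le_one hvw' hwf' hf hcw hsum hp hp'
  have e2 := vn_norm_add_le_one (w := -((c : ℂ) • w)) (by rw [mul_neg, hvw', neg_zero])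
    (by rw [neg_mul, hwf']) hf (by rwa [norm_neg]) hsum hp hp'
  rw [← sub_eq_add_neg] at e2
  refine eq_zero_of_smul_eq_zero (Complex.ofReal_ne_zero.mpr hc0.ne') (hext _ ?_ e1 e2)
  rw [mul_smul_comm, smul_mul_assoc, hqwp]

theorem IsExtremeIn.corner_eq_zero {q p v : VN Γ} (hext : IsExtremeIn q p v)
    (hq : star q = q) (hq' : q * q = q) (hp : star p = p) (hp' : p * p = p)
    (hqv : q * v = v) (hvp : v * p = v) (hv : v * star v * v = v) (y : VN Γ) :
    (q - v * star v) * y * (p - star v * v) = 0 := by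
  have hvq : star v * q = star v := by simpa [hq] using congrArg star hqv
  have hpv : p * star v = star v := by simpa [hp] using congrArg star hvp
  have hv' : star v * v * star v = star v := by
    have := congrArg star hv
    rwa [star_mul, star_mul, star_star, ← mul_assoc] at this
  have hvv : star v * v * (star v * v) = star v * v := by rw [← mul_assoc, hv']
  have hfp : (p - star v * v) * p = p - star v * v := by
    rw [sub_mul, hp', mul_assoc, hvp]
  refine hext.mul_mul_eq_zero hp hp' ?_ ?_ ?_ ?_ hfp (add_sub_cancel _ _) y
  · rw [mul_sub, hq', ← mul_assoc, hqv]
  · rw [mul_sub, hvq, ← mul_assoc, hv', sub_self]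
  · rw [star_sub, star_mul, star_star, hp]
  · rw [mul_sub, hfp, sub_mul, ← mul_assoc p, hpv, hvv, sub_self, sub_zero]

/-- In the von Neumann algebra of an i.c.c. group, projections of equal trace are equivalent. -/
theorem exists_partialIsometry (hΓ : IsICC Γ) {q p : VN Γ} (hq : star q = q) (hq' : q * q = q)
    (hp : star p = p) (hp' : p * p = p) (htr : trace Γ q = trace Γ p) :
    ∃ v : VN Γ, v * star v * v = v ∧ v * star v = q ∧ star v * v = p := by
  obtain ⟨v, hcorner, hv1, hext⟩ := exists_extreme_corner q p
  have hqv : q * v = v := by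
    rw [← hcorner, ← mul_assoc, ← mul_assoc, hq']
  have hvp : v * p = v := by
    rw [← hcorner, mul_assoc, hp']
  have hv := IsExtremeIn.partial_isometry hext hv1 hqv hvp
  have hzero := IsExtremeIn.corner_eq_zero hext hq hq' hp hp' hqv hvp hv
  have hvq : star v * q = star v := by simpa [hq] using congrArg star hqv
  have hpv : p * star v = star v := by simpa [hp] using congrArg star hvp
  -- The two defect projections have equal trace, so the vanishing product of their traces is a
  -- square and both defects are 0.
  have htr' : trace Γ (q - v * star v) = trace Γ (p - star v * v) := by
    rw [map_sub, map_sub, htr, trace_mul_comm]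
  have h := trace_mul_trace_eq_zero hΓ hzero
  rw [htr', mul_self_eq_zero] at h
  refine ⟨v, hv, ?_, ?_⟩
  · refine (sub_eq_zero.mp (eq_zero_of_trace_eq_zero ?_ ?_ (htr'.trans h))).symm
    · rw [star_sub, star_mul, star_star, hq]
    · rw [mul_sub, sub_mul, sub_mul, hq', ← mul_assoc q, hqv, mul_assoc v, hvq, ← mul_assoc, hv,
        sub_self, sub_zero]
  · refine (sub_eq_zero.mp (eq_zero_of_trace_eq_zero ?_ ?_ h)).symm
    · rw [star_sub, star_mul, star_star, hp]
    · rw [mul_sub, sub_mul, sub_mul, hp', ← mul_assoc p, hpv, mul_assoc _ v p, hvp, mul_assoc,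
        ← mul_assoc v, hv, sub_self, sub_zero]

/-- A trace-zero symmetry s gives orthogonal projections (1 ± s)/2 in `VN(G)`, both of trace 1/2,
hence equivalent in `VN(Γ)`. -/
theorem exists_orthogonalIsometry (hΓ : IsICC Γ) {G : Subgroup Γ} [Infinite G]
    (hab : ∀ a ∈ G, ∀ b ∈ G, a * b = b * a) :
    ∃ v, Tracial.IsOrthogonalIsometryFor (M := VN Γ) (subVN G) v := by
  obtain ⟨s, hsG, hs, hss, hs0⟩ := exists_symmetry hab
  have key : ∀ t : VN Γ, star t = t → t * t = 1 →
      star ((1 / 2 : ℂ) • (1 + t)) = (1 / 2 : ℂ) • (1 + t) ∧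
        (1 / 2 : ℂ) • (1 + t) * (1 / 2 : ℂ) • (1 + t) = (1 / 2 : ℂ) • (1 + t) := by
    intro t ht htt
    constructor
    · rw [star_smul, star_add, star_one, ht]
      norm_num
    · rw [smul_mul_smul_comm, add_mul, one_mul, mul_add, mul_one, htt, add_comm t 1,
        ← two_smul ℂ, smul_smul]
      norm_num
  obtain ⟨hp, hp'⟩ := key s hs hss
  obtain ⟨hq, hq'⟩ := key (-s) (by rw [star_neg, hs]) (by rw [neg_mul_neg, hss])
  obtain ⟨v, hv, hvq, hvp⟩ := exists_partialIsometry hΓ hq hq' hp hp' (by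
    rw [map_smul, map_smul, map_add, map_add, map_neg, hs0, neg_zero])
  refine ⟨v, fun h0 => ?_, hv, ?_, ?_, ?_⟩
  · have h1 := congrArg (trace Γ) hvp
    rw [h0, mul_zero, map_zero, map_smul, map_add, hs0, add_zero, trace_one] at h1
    norm_num at h1
  · rw [hvq]
    exact (subVN G).smul_mem (add_mem (one_mem _) (neg_mem hsG)) _
  · rw [hvp]
    exact (subVN G).smul_mem (add_mem (one_mem _) hsG) _
  · rw [hvq, hvp, smul_mul_smul_comm, add_mul, one_mul, mul_add, mul_one, neg_mul, hss]
    rw [show (1 : VN Γ) + s + (-s + -1) = 0 by abel, smul_zero]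

end

end GroupVN

theorem theorem3p3 {Γ : Type*} [Group Γ] [Countable Γ] (hΓ : IsICC Γ)
    (G : Subgroup Γ) (hGinf : Infinite G)
    (hG : ∀ x : Γ, x ∉ G → G.map (MulAut.conj x).toMonoidHom ⊓ G = ⊥) :
    -- the trace-preserving conditional expectations onto `VN(G)` and its conjugates exist
    (∃! E, Tracial.IsCondExp (GroupVN.trace Γ) (GroupVN.subVN G) E) ∧
    (∀ u : unitary (GroupVN.VN Γ),
      ∃! E, Tracial.IsCondExp (GroupVN.trace Γ) (Tracial.conj u (GroupVN.subVN G)) E) ∧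
    -- (i)
    (∀ u : unitary (GroupVN.VN Γ),
      Tracial.norm2 (GroupVN.trace Γ)
          ((u : GroupVN.VN Γ) -
            Tracial.condExp (GroupVN.trace Γ) (GroupVN.subVN G) (u : GroupVN.VN Γ)) ≤
        Tracial.normInfTwo (GroupVN.trace Γ)
          (Tracial.condExp (GroupVN.trace Γ) (Tracial.conj u (GroupVN.subVN G)) -
            Tracial.condExp (GroupVN.trace Γ) (GroupVN.subVN G))) ∧
    -- (ii)
    ((∀ a ∈ G, ∀ b ∈ G, a * b = b * a) →
      Tracial.IsStronglySingularMasa (GroupVN.trace Γ) (GroupVN.subVN G) ∧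
      Tracial.alpha (GroupVN.trace Γ) (GroupVN.subVN G) = 1 ∧
      Tracial.delta (GroupVN.trace Γ) (GroupVN.subVN G) = 1) := by
  have hE := GroupVN.isCondExp_expect G
  refine ⟨⟨_, hE, fun E h => GroupVN.IsCondExp.unique h hE⟩, fun u =>
    ⟨_, GroupVN.isCondExp_conjMap hE u, fun E h => GroupVN.IsCondExp.unique h
      (GroupVN.isCondExp_conjMap hE u)⟩, fun u => ?_, fun hab => ⟨⟨?_, ?_⟩, ?_, ?_⟩⟩
  · have h := GroupVN.isStronglySingularWith_one hG u
    rwa [one_mul] at h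
  · exact GroupVN.isMasa_subVN hG hab
  · exact GroupVN.isStronglySingularWith_one hG
  · exact GroupVN.alpha_subVN hΓ hG hab
  · exact GroupVN.delta_subVN hG hab (GroupVN.exists_orthogonalIsometry hΓ hab)
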